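/- Let $A\to M$ be a Lie algebroid over a (finite-dimensional, Hausdorff, second countable, boundaryless) smooth manifold $M$, i.e. a smooth real vector bundle of finite rank with a Lie algebra structure $[\cdot,\cdot]$ on its space $\Gamma(A)$ of smooth sections and a smooth bundle map $\rho:A\to TM$ (the anchor) such that $\rho([S,T])=[\rho(S),\rho(T)]$ and $[S,fT]=f[S,T]+(\rho(S)\cdot f)\,T$ for $S,T\in\Gamma(A)$, $f\in C^\infty(M)$. Let $(\omega,J,g)$ be a compatible triple on $A$: $\omega$ is a symplectic form on $A$ (a smooth nondegenerate $2$-form on $A$ with $d^A\omega=0$, where $d^A\omega(S,T,U)=\rho(S)\cdot\omega(T,U)-\rho(T)\cdot\omega(S,U)+\rho(U)\cdot\omega(S,T)-\omega([S,T],U)+\omega([S,U],T)-\omega([T,U],S)$), $J$ is a smooth bundle endomorphism of $A$ over the identity with $J^2=-\mathrm{id}$, $g$ is a smooth Riemannian metric on $A$, and $g(JS,JT)=g(S,T)$, $\omega(S,T)=g(S,JT)$ for all $S,T$. For $x\in M$ and a subspace $W\subseteq A_x$ put $W^\omega=\{a\in A_x:\omega(a,b)=0\ \forall b\in W\}$,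 and let $L_x=\ker\rho_x$, $L^1_x=L_x\cap L_x^\omega$, $L^2_x$ the $g$-orthogonal complement of $L^1_x$ in $L_x$, $E^1_x=J(L^1_x)$, $E^2_x=(L_x+E^1_x)^\omega$ and $\Lambda_x=\rho(E^2_x+L^1_x)\subseteq T_xM$. For $f\in C^\infty(M)$ let $a_f$ be the Hamiltonian section of $f$, determined by $\rho(b)\cdot f=\omega(a_f,b)$ for all $b\in A$, and put $\{f,h\}=\omega(a_f,a_h)$. An integral submanifold of $\Lambda$ is a finite-dimensional smooth manifold $\mathcal O$ with an injective immersion $\iota:\mathcal O\to M$ such that $d\iota(T_p\mathcal O)=\Lambda_{\iota(p)}$ for every $p\in\mathcal O$. Then: 1. $A_x=(E^1_x+E^2_x)\oplus(L^1_x+L^2_x)$ for every $x\in M$. 2. $\Lambda$ is a smooth generalized distribution (every $v\in\Lambda_x$ is the value at $x$ of a smooth vector field on $M$ with values in $\Lambda$), and it is integrable: through every point of $M$ passes a connected integral submanifold of $\Lambda$. 3. $\{\cdot,\cdot\}$ is a Poisson bracket on $C^\infty(M)$. 4. For every integral submanifold $\iota:\mathcal O\to M$ of $\Lambda$ there is exactly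 one symplectic form $\omega_{\mathcal O}$ on $\mathcal O$ such that $\omega_{\mathcal O}(X,Y)=\omega(a,b)$ for all $p\in\mathcal O$, $X,Y\in T_p\mathcal O$ and $a,b\in E^2_{\iota(p)}+L^1_{\iota(p)}$ with $\rho(a)=d\iota(X)$, $\rho(b)=d\iota(Y)$. Let $\{u,v\}_{\mathcal O}=\omega_{\mathcal O}(X_u,X_v)$ for $u,v\in C^\infty(\mathcal O)$, where the Hamiltonian vector field $X_u$ is determined by $du=\omega_{\mathcal O}(X_u,\cdot)$. Then $\{\cdot,\cdot\}_{\mathcal O}$ is a Poisson bracket and, for all $f,h\in C^\infty(M)$, $$\{f,h\}|_{\mathcal O}=\{f|_{\mathcal O},h|_{\mathcal O}\}_{\mathcal O},\qquad\text{where } f|_{\mathcal O}=f\circ\iota .$$ -/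

import Mathlib

open Bundle VectorField
open scoped Manifold ContDiff

noncomputable section

/-! Manifolds are modelled on a finite-dimensional real normed space `E` (no boundary), and vector
bundles have a finite-dimensional model fibre `V`. -/

section Algebroids

variable {E : Type*} [NormedAddCommGroup E] [NormedSpace ℝ E]
  {M : Type*} [TopologicalSpace M] [ChartedSpace E M]
  {V : Type*} [NormedAddCommGroup V] [NormedSpace ℝ V]
  {A : M → Type*} [TopologicalSpace (TotalSpace V A)]
  [∀ x, AddCommGroup (A x)] [∀ x, Module ℝ (A x)] [∀ x, TopologicalSpace (A x)]
  [FiberBundle V A] [VectorBundle ℝ V A]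

/-- The product of a smooth function and a smooth section. -/
def sectionSMul (f : C^∞⟮𝓘(ℝ, E), M; ℝ⟯) (S : Cₛ^∞⟮𝓘(ℝ, E); V, A⟯) :
    Cₛ^∞⟮𝓘(ℝ, E); V, A⟯ :=
  ⟨fun x => f x • S x, f.contMDiff.smul_section S.contMDiff⟩

variable (E V A) in
/-- A Lie algebroid structure on the smooth vector bundle `A` over `M`. -/
structure LieAlgebroid [IsManifold 𝓘(ℝ, E) ∞ M] where
  /-- The anchor `A → TM`. -/
  anchor (x : M) : A x →L[ℝ] TangentSpace 𝓘(ℝ, E) x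
  /-- The anchor is a smooth map of total spaces. -/
  contMDiff_anchor : ContMDiff (𝓘(ℝ, E).prod 𝓘(ℝ, V)) 𝓘(ℝ, E).tangent ∞
    (fun v : TotalSpace V A => (⟨v.proj, anchor v.proj v.snd⟩ : TangentBundle 𝓘(ℝ, E) M))
  /-- The bracket on the space of smooth sections. -/
  bracket : Cₛ^∞⟮𝓘(ℝ, E); V, A⟯ →ₗ[ℝ] Cₛ^∞⟮𝓘(ℝ, E); V, A⟯ →ₗ[ℝ] Cₛ^∞⟮𝓘(ℝ, E); V, A⟯
  bracket_self (S : Cₛ^∞⟮𝓘(ℝ, E); V, A⟯) : bracket S S = 0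
  jacobi (S T U : Cₛ^∞⟮𝓘(ℝ, E); V, A⟯) :
    bracket S (bracket T U) = bracket (bracket S T) U + bracket T (bracket S U)
  anchor_bracket (S T : Cₛ^∞⟮𝓘(ℝ, E); V, A⟯) (x : M) :
    anchor x (bracket S T x) =
      mlieBracket 𝓘(ℝ, E) (fun y => anchor y (S y)) (fun y => anchor y (T y)) x
  leibniz (S T : Cₛ^∞⟮𝓘(ℝ, E); V, A⟯) (f : C^∞⟮𝓘(ℝ, E), M; ℝ⟯) (x : M) :
    bracket S (sectionSMul f T) x =
      f x • bracket S T x + mvfderiv 𝓘(ℝ, E) f x (anchor x (S x)) • T x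

namespace LieAlgebroid

variable [IsManifold 𝓘(ℝ, E) ∞ M]

/-- The differential of a smooth function: `(d^A f)(b) = ρ(b) · f` for `b` in the fibre at `x`. -/
def d₀ (𝓐 : LieAlgebroid E V A) (f : C^∞⟮𝓘(ℝ, E), M; ℝ⟯) (x : M) : A x →L[ℝ] ℝ :=
  (mvfderiv 𝓘(ℝ, E) f x).comp (𝓐.anchor x)

/-- The exterior derivative `(d^A η)(S, T, U)` of a 2-form `η` on `A`. -/
def d₂ (𝓐 : LieAlgebroid E V A) (η : ∀ x, A x →L[ℝ] A x →L[ℝ] ℝ)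
    (S T U : Cₛ^∞⟮𝓘(ℝ, E); V, A⟯) (x : M) : ℝ :=
  mvfderiv 𝓘(ℝ, E) (fun y => η y (T y) (U y)) x (𝓐.anchor x (S x))
    - mvfderiv 𝓘(ℝ, E) (fun y => η y (S y) (U y)) x (𝓐.anchor x (T x))
    + mvfderiv 𝓘(ℝ, E) (fun y => η y (S y) (T y)) x (𝓐.anchor x (U x))
    - η x (𝓐.bracket S T x) (U x)
    + η x (𝓐.bracket S U x) (T x)
    - η x (𝓐.bracket T U x) (S x)

/-- The kernel of the anchor at `x`. -/
def L (𝓐 : LieAlgebroid E V A) (x : M) : Submodule ℝ (A x) :=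
  LinearMap.ker (𝓐.anchor x).toLinearMap

end LieAlgebroid

variable [IsManifold 𝓘(ℝ, E) ∞ M]
  [∀ x, IsTopologicalAddGroup (A x)] [∀ x, ContinuousConstSMul ℝ (A x)]

/-- A symplectic form on a Lie algebroid: a smooth, alternating, nondegenerate, closed 2-form. -/
@[ext]
structure SymplecticForm (𝓐 : LieAlgebroid E V A) where
  form (x : M) : A x →L[ℝ] A x →L[ℝ] ℝ
  contMDiff : ContMDiff 𝓘(ℝ, E) (𝓘(ℝ, E).prod 𝓘(ℝ, V →L[ℝ] V →L[ℝ] ℝ)) ∞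
    (fun x => TotalSpace.mk' (V →L[ℝ] V →L[ℝ] ℝ) x (form x))
  alternating (x : M) (a : A x) : form x a a = 0
  nondegenerate (x : M) (a : A x) : (∀ b, form x a b = 0) → a = 0
  closed (S T U : Cₛ^∞⟮𝓘(ℝ, E); V, A⟯) (x : M) : 𝓐.d₂ form S T U x = 0

namespace SymplecticForm

variable {𝓐 : LieAlgebroid E V A} (Ω : SymplecticForm 𝓐)

/-- The `Ω`-orthogonal of a subspace of a fibre. -/
def orth (x : M) (W : Submodule ℝ (A x)) : Submodule ℝ (A x) where
  carrier := {a | ∀ b ∈ W, Ω.form x a b = 0}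
  add_mem' ha ha' b hb := by simp [ha b hb, ha' b hb]
  zero_mem' b _ := by simp
  smul_mem' c a ha b hb := by simp [ha b hb]

theorem existsUnique_hamiltonian [FiniteDimensional ℝ V] (f : C^∞⟮𝓘(ℝ, E), M; ℝ⟯) (x : M) :
    ∃! a : A x, ∀ b : A x, 𝓐.d₀ f x b = Ω.form x a b := by
  have : FiniteDimensional ℝ (A x) := VectorBundle.finiteDimensional ℝ V A x
  let B : A x →ₗ[ℝ] Module.Dual ℝ (A x) :=
    { toFun := fun a => (Ω.form x a).toLinearMap
      map_add' := fun a b => by ext; simp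
      map_smul' := fun c a => by ext; simp }
  have hinj : Function.Injective B := by
    rw [injective_iff_map_eq_zero]
    intro a ha
    exact Ω.nondegenerate x a fun b => LinearMap.congr_fun ha b
  have hsurj : Function.Surjective B :=
    (LinearMap.injective_iff_surjective_of_finrank_eq_finrank
      (Subspace.dual_finrank_eq (K := ℝ) (V := A x)).symm).1 hinj
  obtain ⟨a, ha⟩ := hsurj (𝓐.d₀ f x).toLinearMap
  refine ⟨a, fun b => (LinearMap.congr_fun ha b).symm, fun a' ha' => hinj ?_⟩
  ext b
  exact (ha' b).symm.trans (LinearMap.congr_fun ha b).symm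

/-- The Hamiltonian section `a_f` of `f`, determined by `d^A f (b) = Ω (a_f, b)` for all `b`. -/
def hamiltonian [FiniteDimensional ℝ V] (f : C^∞⟮𝓘(ℝ, E), M; ℝ⟯) (x : M) : A x :=
  (Ω.existsUnique_hamiltonian f x).choose

/-- The bracket `{f, h} = Ω (a_f, a_h)` induced by `Ω` on functions on the base. -/
def poissonBracket [FiniteDimensional ℝ V] (f h : C^∞⟮𝓘(ℝ, E), M; ℝ⟯) (x : M) : ℝ :=
  Ω.form x (Ω.hamiltonian f x) (Ω.hamiltonian h x)

end SymplecticForm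

/-- A compatible triple `(Ω, J, g)` on a Lie algebroid. -/
structure CompatibleTriple (𝓐 : LieAlgebroid E V A) where
  Ω : SymplecticForm 𝓐
  /-- The almost complex structure, a smooth bundle endomorphism over the identity. -/
  J (x : M) : A x →L[ℝ] A x
  contMDiff_J : ContMDiff (𝓘(ℝ, E).prod 𝓘(ℝ, V)) (𝓘(ℝ, E).prod 𝓘(ℝ, V)) ∞
    (fun v : TotalSpace V A => (⟨v.proj, J v.proj v.snd⟩ : TotalSpace V A))
  J_J (x : M) (a : A x) : J x (J x a) = -a
  /-- The Riemannian metric on the fibres. -/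
  g : ContMDiffRiemannianMetric 𝓘(ℝ, E) ∞ V A
  g_J_J (x : M) (a b : A x) : g.inner x (J x a) (J x b) = g.inner x a b
  Ω_eq (x : M) (a b : A x) : Ω.form x a b = g.inner x a (J x b)

namespace CompatibleTriple

variable {𝓐 : LieAlgebroid E V A} (τ : CompatibleTriple 𝓐)

/-- `L¹ = L ∩ L^Ω`. -/
def L₁ (x : M) : Submodule ℝ (A x) := 𝓐.L x ⊓ τ.Ω.orth x (𝓐.L x)

/-- `L²`, the `g`-orthogonal complement of `L¹` in `L`. -/
def L₂ (x : M) : Submodule ℝ (A x) where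
  carrier := {s | s ∈ 𝓐.L x ∧ ∀ t ∈ τ.L₁ x, τ.g.inner x s t = 0}
  add_mem' ha hb := ⟨add_mem ha.1 hb.1, fun t ht => by simp [ha.2 t ht, hb.2 t ht]⟩
  zero_mem' := ⟨zero_mem _, fun t _ => by simp⟩
  smul_mem' c a ha := ⟨Submodule.smul_mem _ c ha.1, fun t ht => by simp [ha.2 t ht]⟩

/-- `E¹ = J(L¹)`. -/
def E₁ (x : M) : Submodule ℝ (A x) := (τ.L₁ x).map (τ.J x).toLinearMap

/-- `E² = (L + E¹)^Ω`. -/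
def E₂ (x : M) : Submodule ℝ (A x) := τ.Ω.orth x (𝓐.L x ⊔ τ.E₁ x)

/-- The symplectic generalized distribution `Λ = ρ(E² + L¹)`. -/
def Λ (x : M) : Submodule ℝ (TangentSpace 𝓘(ℝ, E) x) :=
  (τ.E₂ x ⊔ τ.L₁ x).map (𝓐.anchor x).toLinearMap

end CompatibleTriple

end Algebroids

section Manifolds

variable {E : Type*} [NormedAddCommGroup E] [NormedSpace ℝ E]
  {M : Type*} [TopologicalSpace M] [ChartedSpace E M]

/-- `P` is a Poisson bracket on the smooth functions on `M`. -/
structure IsPoissonBracket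
    (P : C^∞⟮𝓘(ℝ, E), M; ℝ⟯ → C^∞⟮𝓘(ℝ, E), M; ℝ⟯ → M → ℝ) : Prop where
  contMDiff (f h : C^∞⟮𝓘(ℝ, E), M; ℝ⟯) : ContMDiff 𝓘(ℝ, E) 𝓘(ℝ, ℝ) ∞ (P f h)
  add_left (f₁ f₂ h : C^∞⟮𝓘(ℝ, E), M; ℝ⟯) : P (f₁ + f₂) h = P f₁ h + P f₂ h
  smul_left (c : ℝ) (f h : C^∞⟮𝓘(ℝ, E), M; ℝ⟯) : P (c • f) h = c • P f h
  skew (f h : C^∞⟮𝓘(ℝ, E), M; ℝ⟯) : P f h = -P h f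
  leibniz (f h k : C^∞⟮𝓘(ℝ, E), M; ℝ⟯) : P f (h * k) = P f h * k + h * P f k
  jacobi (f h k : C^∞⟮𝓘(ℝ, E), M; ℝ⟯) :
    P f ⟨P h k, contMDiff h k⟩ + P h ⟨P k f, contMDiff k f⟩ + P k ⟨P f h, contMDiff f h⟩ = 0

/-- A generalized distribution (of possibly varying rank) is smooth if each of its vectors is the
value of a smooth vector field tangent to the distribution. -/
def IsSmoothDistribution [IsManifold 𝓘(ℝ, E) ∞ M]
    (D : ∀ x : M, Submodule ℝ (TangentSpace 𝓘(ℝ, E) x)) : Prop :=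
  ∀ (x : M), ∀ v ∈ D x,
    ∃ X : Cₛ^∞⟮𝓘(ℝ, E); E, (TangentSpace 𝓘(ℝ, E) : M → Type _)⟯, X x = v ∧ ∀ y, X y ∈ D y

/-- `ι : O → M` is an integral submanifold of `D`: an injective immersion whose tangent spaces are
the spaces of the distribution. -/
structure IsIntegralSubmanifold (D : ∀ x : M, Submodule ℝ (TangentSpace 𝓘(ℝ, E) x))
    {F : Type*} [NormedAddCommGroup F] [NormedSpace ℝ F]
    {O : Type*} [TopologicalSpace O] [ChartedSpace F O] (ι : O → M) : Prop where
  contMDiff : ContMDiff 𝓘(ℝ, F) 𝓘(ℝ, E) ∞ ι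
  injective : Function.Injective ι
  immersion (p : O) : Function.Injective (mfderiv 𝓘(ℝ, F) 𝓘(ℝ, E) ι p)
  range_mfderiv (p : O) :
    LinearMap.range (mfderiv 𝓘(ℝ, F) 𝓘(ℝ, E) ι p).toLinearMap = D (ι p)

/-- A generalized distribution is integrable if a connected integral submanifold passes through
every point. -/
def IsIntegrableDistribution (D : ∀ x : M, Submodule ℝ (TangentSpace 𝓘(ℝ, E) x)) : Prop :=
  ∀ x : M, ∃ (k : ℕ) (O : Type) (_ : TopologicalSpace O)
    (_ : ChartedSpace (EuclideanSpace ℝ (Fin k)) O)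
    (_ : IsManifold 𝓘(ℝ, EuclideanSpace ℝ (Fin k)) ∞ O)
    (_ : T2Space O) (_ : SecondCountableTopology O) (_ : ConnectedSpace O) (ι : O → M),
    IsIntegralSubmanifold (F := EuclideanSpace ℝ (Fin k)) D ι ∧ x ∈ Set.range ι

theorem mdifferentiableAt_vectorField [IsManifold 𝓘(ℝ, E) ∞ M]
    (S : Cₛ^∞⟮𝓘(ℝ, E); E, (TangentSpace 𝓘(ℝ, E) : M → Type _)⟯) (x : M) :
    MDifferentiableAt 𝓘(ℝ, E) 𝓘(ℝ, E).tangent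
      (fun y => (⟨y, S y⟩ : TangentBundle 𝓘(ℝ, E) M)) x :=
  S.contMDiff.mdifferentiable (by simp) x

theorem contMDiff_mlieBracket_section [FiniteDimensional ℝ E] [IsManifold 𝓘(ℝ, E) ∞ M]
    (S T : Cₛ^∞⟮𝓘(ℝ, E); E, (TangentSpace 𝓘(ℝ, E) : M → Type _)⟯) :
    ContMDiff 𝓘(ℝ, E) 𝓘(ℝ, E).tangent ∞
      (fun y => (⟨y, mlieBracket 𝓘(ℝ, E) S T y⟩ : TangentBundle 𝓘(ℝ, E) M)) := by
  have : CompleteSpace E := FiniteDimensional.complete ℝ E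
  have : IsManifold 𝓘(ℝ, E) (((⊤ : ℕ∞) : ℕ∞ω) + 1) M := by
    simpa using (inferInstance : IsManifold 𝓘(ℝ, E) ∞ M)
  have : IsManifold 𝓘(ℝ, E) (minSmoothness ℝ 2) M := by
    simp only [minSmoothness_of_isRCLikeNormedField]; infer_instance
  exact ContDiff.mlieBracket_vectorField (m := ⊤) (n := ⊤) S.contMDiff T.contMDiff (by simp)

variable (E M) in
/-- The tangent Lie algebroid: `TM` with the identity as anchor and the bracket of vector fields.
A symplectic form on it is a symplectic form on `M` in the usual sense. -/
def tangentLieAlgebroid [FiniteDimensional ℝ E] [IsManifold 𝓘(ℝ, E) ∞ M] :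
    LieAlgebroid E E (TangentSpace 𝓘(ℝ, E) : M → Type _) where
  anchor x := ContinuousLinearMap.id ℝ _
  contMDiff_anchor := contMDiff_id
  bracket :=
    LinearMap.mk₂ ℝ
      (fun S T => ⟨mlieBracket 𝓘(ℝ, E) S T, contMDiff_mlieBracket_section S T⟩)
      (fun S S' T => by
        have : CompleteSpace E := FiniteDimensional.complete ℝ E
        ext x
        exact mlieBracket_add_left (mdifferentiableAt_vectorField S x)
          (mdifferentiableAt_vectorField S' x))
      (fun c S T => by
        have : CompleteSpace E := FiniteDimensional.complete ℝ E
        ext x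
        exact mlieBracket_const_smul_left (mdifferentiableAt_vectorField S x))
      (fun S T T' => by
        have : CompleteSpace E := FiniteDimensional.complete ℝ E
        ext x
        exact mlieBracket_add_right (mdifferentiableAt_vectorField T x)
          (mdifferentiableAt_vectorField T' x))
      (fun c S T => by
        have : CompleteSpace E := FiniteDimensional.complete ℝ E
        ext x
        exact mlieBracket_const_smul_right (mdifferentiableAt_vectorField T x))
  bracket_self S := by
    ext x
    exact congrFun mlieBracket_self x
  jacobi S T U := by
    have : CompleteSpace E := FiniteDimensional.complete ℝ E
    have : IsManifold 𝓘(ℝ, E) (minSmoothness ℝ 3) M := by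
      simp only [minSmoothness_of_isRCLikeNormedField]; infer_instance
    have hd (S : Cₛ^∞⟮𝓘(ℝ, E); E, (TangentSpace 𝓘(ℝ, E) : M → Type _)⟯) (x : M) :
        ContMDiffAt 𝓘(ℝ, E) 𝓘(ℝ, E).tangent (minSmoothness ℝ 2)
          (fun y => (⟨y, S y⟩ : TangentBundle 𝓘(ℝ, E) M)) x :=
      (S.contMDiff x).of_le (by
        simp only [minSmoothness_of_isRCLikeNormedField]; exact ENat.LEInfty.out)
    ext x
    exact leibniz_identity_mlieBracket_apply (hd S x) (hd T x) (hd U x)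
  anchor_bracket S T x := rfl
  leibniz S T f x := by
    have : CompleteSpace E := FiniteDimensional.complete ℝ E
    rw [add_comm]
    exact mlieBracket_smul_right (f.contMDiff.mdifferentiable (by simp) x)
      (mdifferentiableAt_vectorField T x)

end Manifolds

/-- `ΩO` is the 2-form induced on the integral submanifold `ι : O → M` of `Λ`:
`ΩO (X, Y) = Ω (a, b)` whenever `a, b ∈ E² + L¹` lift `X, Y`. -/
def IsInducedForm {E : Type*} [NormedAddCommGroup E] [NormedSpace ℝ E]
    {M : Type*} [TopologicalSpace M] [ChartedSpace E M] [IsManifold 𝓘(ℝ, E) ∞ M]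
    {V : Type*} [NormedAddCommGroup V] [NormedSpace ℝ V]
    {A : M → Type*} [TopologicalSpace (TotalSpace V A)]
    [∀ x, AddCommGroup (A x)] [∀ x, Module ℝ (A x)] [∀ x, TopologicalSpace (A x)]
    [∀ x, IsTopologicalAddGroup (A x)] [∀ x, ContinuousConstSMul ℝ (A x)]
    [FiberBundle V A] [VectorBundle ℝ V A]
    {𝓐 : LieAlgebroid E V A} (τ : CompatibleTriple 𝓐)
    {F : Type*} [NormedAddCommGroup F] [NormedSpace ℝ F] [FiniteDimensional ℝ F]
    {O : Type*} [TopologicalSpace O] [ChartedSpace F O] [IsManifold 𝓘(ℝ, F) ∞ O]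
    (ι : O → M) (ΩO : SymplecticForm (tangentLieAlgebroid F O)) : Prop :=
  ∀ (p : O) (X Y : TangentSpace 𝓘(ℝ, F) p), ∀ a ∈ τ.E₂ (ι p) ⊔ τ.L₁ (ι p),
    ∀ b ∈ τ.E₂ (ι p) ⊔ τ.L₁ (ι p),
    𝓐.anchor (ι p) a = mfderiv 𝓘(ℝ, F) 𝓘(ℝ, E) ι p X →
    𝓐.anchor (ι p) b = mfderiv 𝓘(ℝ, F) 𝓘(ℝ, E) ι p Y →
    ΩO.form p X Y = τ.Ω.form (ι p) a b

end

/-! The Jacobi identity forces the anchor to preserve brackets of vector fields, so evaluating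
`d^A ω = 0` on Hamiltonian sections gives the Jacobi identity of `{·, ·}`. Pointwise linear algebra
identifies `E² + L¹` with `L^ω`; hence `Λ = ρ(L^ω)` is the range of the Poisson tensor of `{·, ·}`
and is spanned by Hamiltonian vector fields.

In a chart, with `B` the Poisson tensor, let `γ_ξ` solve `γ' = B(γ) ξ` for a constant covector `ξ`,
starting at the given point. The Jacobi identity says that `B` is transported along `γ_ξ` by the
linearised flow and its adjoint, so the rank of `B` is constant along `γ_ξ`, and variation of
constants shows that the differential of `ξ ↦ γ_ξ(1)` takes values in the range of `B`. Restricted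
to a complement of `ker B`, this map is therefore a leaf. It is smooth in `ξ` by the implicit
function theorem in `C([0, 1], E)`.

On a leaf, the Hamiltonian vector fields of restrictions of functions of `M` span every tangent
space, so the induced form is determined by the values `{f, h}`: it is smooth because these are,
and closed by the Jacobi identity.
-/

section SmoothSections

open Filter Topology

variable {E : Type*} [NormedAddCommGroup E] [NormedSpace ℝ E]
  {M : Type*} [TopologicalSpace M] [ChartedSpace E M]
  {V : Type*} [NormedAddCommGroup V] [NormedSpace ℝ V]

theorem contMDiffAt_of_injective_clm_apply [FiniteDimensional ℝ V]
    {W : Type*} [NormedAddCommGroup W] [NormedSpace ℝ W] [FiniteDimensional ℝ W]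
    {n : ℕ∞ω} {Φ : M → V →L[ℝ] W} {u : M → V} {x₀ : M}
    (hΦ : ContMDiffAt 𝓘(ℝ, E) 𝓘(ℝ, V →L[ℝ] W) n Φ x₀) (hinj : Function.Injective (Φ x₀))
    (hΦu : ContMDiffAt 𝓘(ℝ, E) 𝓘(ℝ, W) n (fun x => Φ x (u x)) x₀) :
    ContMDiffAt 𝓘(ℝ, E) 𝓘(ℝ, V) n u x₀ := by
  have : CompleteSpace V := FiniteDimensional.complete ℝ V
  obtain ⟨R₀, hR₀⟩ := (Φ x₀).toLinearMap.exists_leftInverse_of_injective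
    (LinearMap.ker_eq_bot.2 hinj)
  let R : W →L[ℝ] V := LinearMap.toContinuousLinearMap R₀
  let T : M → V →L[ℝ] V := fun x => R.comp (Φ x)
  have hT : ContMDiffAt 𝓘(ℝ, E) 𝓘(ℝ, V →L[ℝ] V) n T x₀ := contMDiffAt_const.clm_comp hΦ
  have hTx₀ : T x₀ = (ContinuousLinearEquiv.refl ℝ V : V →L[ℝ] V) :=
    ContinuousLinearMap.ext fun v => LinearMap.congr_fun hR₀ v
  have hTinv : ContMDiffAt 𝓘(ℝ, E) 𝓘(ℝ, V →L[ℝ] V) n (fun x => (T x).inverse) x₀ := by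
    have h : ContDiffAt ℝ n ContinuousLinearMap.inverse (T x₀) := by
      rw [hTx₀]
      exact contDiffAt_map_inverse _
    exact h.contMDiffAt.comp x₀ hT
  have hT_invertible : ∀ᶠ x in 𝓝 x₀, T x ∈ Set.range ((↑) : (V ≃L[ℝ] V) → V →L[ℝ] V) := by
    refine hT.continuousAt.eventually ?_
    rw [hTx₀]
    exact ContinuousLinearEquiv.nhds _
  refine (hTinv.clm_apply (R.contMDiff.contMDiffAt.comp x₀ hΦu)).congr_of_eventuallyEq ?_
  filter_upwards [hT_invertible] with x ⟨L, hL⟩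
  change u x = (T x).inverse (T x (u x))
  simp [← hL]

variable {A : M → Type*} [TopologicalSpace (TotalSpace V A)]
  [∀ x, AddCommGroup (A x)] [∀ x, Module ℝ (A x)] [∀ x, TopologicalSpace (A x)]
  [FiberBundle V A] [VectorBundle ℝ V A]

theorem sectionSMul_apply (f : C^∞⟮𝓘(ℝ, E), M; ℝ⟯) (S : Cₛ^∞⟮𝓘(ℝ, E); V, A⟯) (x : M) :
    sectionSMul f S x = f x • S x := rfl

theorem contMDiffAt_section_of_linearForms [FiniteDimensional ℝ V]
    [ContMDiffVectorBundle ∞ V A 𝓘(ℝ, E)] {x₀ : M} {s : ∀ x, A x} {κ : Type*} [Finite κ]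
    (φ : κ → ∀ x, A x →ₗ[ℝ] ℝ)
    (hφ : ∀ j (t : ∀ x, A x),
      ContMDiffAt 𝓘(ℝ, E) (𝓘(ℝ, E).prod 𝓘(ℝ, V)) ∞ (fun x => TotalSpace.mk' V x (t x)) x₀ →
      ContMDiffAt 𝓘(ℝ, E) 𝓘(ℝ, ℝ) ∞ (fun x => φ j x (t x)) x₀)
    (hinj : ∀ a : A x₀, (∀ j, φ j x₀ a = 0) → a = 0)
    (hs : ∀ j, ContMDiffAt 𝓘(ℝ, E) 𝓘(ℝ, ℝ) ∞ (fun x => φ j x (s x)) x₀) :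
    ContMDiffAt 𝓘(ℝ, E) (𝓘(ℝ, E).prod 𝓘(ℝ, V)) ∞ (fun x => TotalSpace.mk' V x (s x)) x₀ := by
  have := Fintype.ofFinite κ
  let e := trivializationAt V A x₀
  have hx₀ : x₀ ∈ e.baseSet := FiberBundle.mem_baseSet_trivializationAt V A x₀
  let b := Module.finBasis ℝ V
  let ofMatrix : (Fin (Module.finrank ℝ V) → κ → ℝ) →L[ℝ] V →L[ℝ] (κ → ℝ) :=
    LinearMap.toContinuousLinearMap
      (LinearMap.toContinuousLinearMap.toLinearMap ∘ₗ (b.constr ℝ).toLinearMap)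
  let Φ : M → V →L[ℝ] (κ → ℝ) := fun x => ofMatrix fun i j => φ j x (e.localFrame b i x)
  have hΦ_apply : ∀ x ∈ e.baseSet, ∀ a : A x, Φ x (e ⟨x, a⟩).2 = fun j => φ j x a := by
    intro x hx a
    have ha : ∑ i, b.repr (e ⟨x, a⟩).2 i • e.localFrame b i x = a := by
      simp only [e.localFrame_apply_of_mem_baseSet b hx]
      exact (e.basisAt b hx).sum_repr a
    change b.constr (M' := κ → ℝ) ℝ (fun i j => φ j x (e.localFrame b i x)) (e ⟨x, a⟩).2 = _
    ext j
    conv_rhs => rw [← ha]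
    simp [Module.Basis.constr_apply_fintype, Module.Basis.equivFun_apply]
  have hΦ : ContMDiffAt 𝓘(ℝ, E) 𝓘(ℝ, V →L[ℝ] (κ → ℝ)) ∞ Φ x₀ :=
    ofMatrix.contMDiff.contMDiffAt.comp x₀ <| contMDiffAt_pi_space.2 fun i =>
      contMDiffAt_pi_space.2 fun j => hφ j _ (contMDiffAt_localFrame_of_mem ∞ e b i hx₀)
  have hΦ_inj : Function.Injective (Φ x₀) := by
    rw [injective_iff_map_eq_zero]
    intro v hv
    obtain ⟨a, rfl⟩ := (e.linearEquivAt ℝ x₀ hx₀).surjective v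
    rw [hinj a fun j => congrFun ((hΦ_apply x₀ hx₀ a).symm.trans hv) j, map_zero]
  rw [e.contMDiffAt_section_iff hx₀]
  refine contMDiffAt_of_injective_clm_apply hΦ hΦ_inj
    ((contMDiffAt_pi_space.2 hs).congr_of_eventuallyEq ?_)
  filter_upwards [e.open_baseSet.mem_nhds hx₀] with x hx using hΦ_apply x hx (s x)

theorem contMDiffAt_mvfderiv_apply [IsManifold 𝓘(ℝ, E) ∞ M] (f : C^∞⟮𝓘(ℝ, E), M; ℝ⟯)
    {X : ∀ x : M, TangentSpace 𝓘(ℝ, E) x} {x : M}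
    (hX : ContMDiffAt 𝓘(ℝ, E) 𝓘(ℝ, E).tangent ∞
      (fun y => (⟨y, X y⟩ : TangentBundle 𝓘(ℝ, E) M)) x) :
    ContMDiffAt 𝓘(ℝ, E) 𝓘(ℝ, ℝ) ∞ (fun y => mvfderiv 𝓘(ℝ, E) f y (X y)) x :=
  (contMDiff_snd_tangentBundle_modelSpace ℝ 𝓘(ℝ, ℝ)).contMDiffAt.comp x
    ((f.contMDiff.contMDiff_tangentMap (m := ∞) (by simp)).contMDiffAt.comp x hX)

end SmoothSections

section AlternatingForms

theorem apply_swap_of_apply_self {W : Type*} [AddCommGroup W] [Module ℝ W] [TopologicalSpace W]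
    {B : W →L[ℝ] W →L[ℝ] ℝ} (hB : ∀ a, B a a = 0) (a b : W) : B a b = -B b a :=
  (LinearMap.IsAlt.neg (B := B.toBilinForm) hB b a).symm

variable {E : Type*} [NormedAddCommGroup E] [NormedSpace ℝ E]
  {M : Type*} [TopologicalSpace M] [ChartedSpace E M]
  {A : M → Type*} [∀ x, AddCommGroup (A x)] [∀ x, Module ℝ (A x)] [∀ x, TopologicalSpace (A x)]
  {η : ∀ x, A x →L[ℝ] A x →L[ℝ] ℝ}

theorem mvfderiv_form_swap (hη : ∀ x a, η x a a = 0) (S T : ∀ x, A x) (x : M)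
    (v : TangentSpace 𝓘(ℝ, E) x) :
    mvfderiv 𝓘(ℝ, E) (fun y => η y (S y) (T y)) x v =
      -mvfderiv 𝓘(ℝ, E) (fun y => η y (T y) (S y)) x v := by
  simp_rw [fun y => apply_swap_of_apply_self (hη y) (S y), mvfderiv_fun_neg, neg_apply]

end AlternatingForms

namespace LieAlgebroid

variable {E : Type*} [NormedAddCommGroup E] [NormedSpace ℝ E]
  {M : Type*} [TopologicalSpace M] [ChartedSpace E M] [IsManifold 𝓘(ℝ, E) ∞ M]
  {V : Type*} [NormedAddCommGroup V] [NormedSpace ℝ V]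
  {A : M → Type*} [TopologicalSpace (TotalSpace V A)]
  [∀ x, AddCommGroup (A x)] [∀ x, Module ℝ (A x)] [∀ x, TopologicalSpace (A x)]
  [FiberBundle V A] [VectorBundle ℝ V A]
  (𝓐 : LieAlgebroid E V A)

theorem contMDiffAt_anchor_apply {S : ∀ x, A x} {x : M}
    (hS : ContMDiffAt 𝓘(ℝ, E) (𝓘(ℝ, E).prod 𝓘(ℝ, V)) ∞ (fun y => TotalSpace.mk' V y (S y)) x) :
    ContMDiffAt 𝓘(ℝ, E) 𝓘(ℝ, E).tangent ∞
      (fun y => (⟨y, 𝓐.anchor y (S y)⟩ : TangentBundle 𝓘(ℝ, E) M)) x :=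
  (𝓐.contMDiff_anchor.contMDiffAt).comp x hS

theorem contMDiffAt_d₀ (f : C^∞⟮𝓘(ℝ, E), M; ℝ⟯) {S : ∀ x, A x} {x : M}
    (hS : ContMDiffAt 𝓘(ℝ, E) (𝓘(ℝ, E).prod 𝓘(ℝ, V)) ∞ (fun y => TotalSpace.mk' V y (S y)) x) :
    ContMDiffAt 𝓘(ℝ, E) 𝓘(ℝ, ℝ) ∞ (fun y => 𝓐.d₀ f y (S y)) x :=
  contMDiffAt_mvfderiv_apply f (𝓐.contMDiffAt_anchor_apply hS)

/-- The derivative `ρ(S) · f` of a function along a section. -/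
noncomputable def derivAlong (S : Cₛ^∞⟮𝓘(ℝ, E); V, A⟯) (f : C^∞⟮𝓘(ℝ, E), M; ℝ⟯) :
    C^∞⟮𝓘(ℝ, E), M; ℝ⟯ :=
  ⟨fun x => 𝓐.d₀ f x (S x), fun x => 𝓐.contMDiffAt_d₀ f (S.contMDiff x)⟩

theorem derivAlong_apply (S : Cₛ^∞⟮𝓘(ℝ, E); V, A⟯) (f : C^∞⟮𝓘(ℝ, E), M; ℝ⟯) (x : M) :
    𝓐.derivAlong S f x = 𝓐.d₀ f x (S x) := rfl

theorem bracket_sectionSMul (S T : Cₛ^∞⟮𝓘(ℝ, E); V, A⟯) (f : C^∞⟮𝓘(ℝ, E), M; ℝ⟯) :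
    𝓐.bracket S (sectionSMul f T) =
      sectionSMul f (𝓐.bracket S T) + sectionSMul (𝓐.derivAlong S f) T := by
  ext x
  exact 𝓐.leibniz S T f x

-- The Jacobi identity for `S`, `T` and `f U` differs from `f` times that for `S`, `T` and `U` by
-- the difference of the two sides, times `U`.
theorem d₀_bracket (S T : Cₛ^∞⟮𝓘(ℝ, E); V, A⟯) (f : C^∞⟮𝓘(ℝ, E), M; ℝ⟯) (x : M) :
    𝓐.d₀ f x (𝓐.bracket S T x) =
      𝓐.d₀ (𝓐.derivAlong T f) x (S x) - 𝓐.d₀ (𝓐.derivAlong S f) x (T x) := by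
  have smul_eq_zero_of_jacobi (U : Cₛ^∞⟮𝓘(ℝ, E); V, A⟯) :
      (𝓐.d₀ f x (𝓐.bracket S T x) -
        (𝓐.d₀ (𝓐.derivAlong T f) x (S x) - 𝓐.d₀ (𝓐.derivAlong S f) x (T x))) • U x = 0 := by
    have hfU := DFunLike.congr_fun (𝓐.jacobi S T (sectionSMul f U)) x
    have hU := DFunLike.congr_fun (𝓐.jacobi S T U) x
    simp only [bracket_sectionSMul, map_add, ContMDiffSection.coe_add, Pi.add_apply,
      sectionSMul_apply, derivAlong_apply] at hfU hU
    rw [hU, ← sub_eq_zero] at hfU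
    rw [← neg_eq_zero, ← hfU]
    module
  by_cases hU : ∃ U : Cₛ^∞⟮𝓘(ℝ, E); V, A⟯, U x ≠ 0
  · obtain ⟨U, hU⟩ := hU
    exact sub_eq_zero.1 ((smul_eq_zero.1 (smul_eq_zero_of_jacobi U)).resolve_right hU)
  · push Not at hU
    simp [hU]

theorem form_bracket_of_hamiltonian {η : ∀ x, A x →L[ℝ] A x →L[ℝ] ℝ} (hη : ∀ x a, η x a a = 0)
    {U : Cₛ^∞⟮𝓘(ℝ, E); V, A⟯} {k : C^∞⟮𝓘(ℝ, E), M; ℝ⟯}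
    (hU : ∀ x b, 𝓐.d₀ k x b = η x (U x) b) (S T : Cₛ^∞⟮𝓘(ℝ, E); V, A⟯) (x : M) :
    η x (𝓐.bracket S T x) (U x) =
      mvfderiv 𝓘(ℝ, E) (fun y => η y (U y) (S y)) x (𝓐.anchor x (T x)) -
        mvfderiv 𝓘(ℝ, E) (fun y => η y (U y) (T y)) x (𝓐.anchor x (S x)) := by
  have derivAlong_eq (Z : Cₛ^∞⟮𝓘(ℝ, E); V, A⟯) :
      (𝓐.derivAlong Z k : M → ℝ) = fun y => η y (U y) (Z y) :=
    funext fun y => hU y (Z y)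
  rw [apply_swap_of_apply_self (hη x), ← hU, d₀_bracket]
  simp only [d₀, ContinuousLinearMap.comp_apply, derivAlong_eq, neg_sub]

theorem d₂_of_hamiltonian {η : ∀ x, A x →L[ℝ] A x →L[ℝ] ℝ} (hη : ∀ x a, η x a a = 0)
    {S T U : Cₛ^∞⟮𝓘(ℝ, E); V, A⟯} {f h k : C^∞⟮𝓘(ℝ, E), M; ℝ⟯}
    (hS : ∀ x b, 𝓐.d₀ f x b = η x (S x) b) (hT : ∀ x b, 𝓐.d₀ h x b = η x (T x) b)
    (hU : ∀ x b, 𝓐.d₀ k x b = η x (U x) b) (x : M) :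
    𝓐.d₂ η S T U x =
      -(mvfderiv 𝓘(ℝ, E) (fun y => η y (T y) (U y)) x (𝓐.anchor x (S x)) +
        mvfderiv 𝓘(ℝ, E) (fun y => η y (U y) (S y)) x (𝓐.anchor x (T x)) +
        mvfderiv 𝓘(ℝ, E) (fun y => η y (S y) (T y)) x (𝓐.anchor x (U x))) := by
  rw [d₂, 𝓐.form_bracket_of_hamiltonian hη hU, 𝓐.form_bracket_of_hamiltonian hη hT,
    𝓐.form_bracket_of_hamiltonian hη hS, mvfderiv_form_swap hη U T, mvfderiv_form_swap hη T S,
    mvfderiv_form_swap hη U S]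
  ring

end LieAlgebroid

namespace SymplecticForm

variable {E : Type*} [NormedAddCommGroup E] [NormedSpace ℝ E]
  {M : Type*} [TopologicalSpace M] [ChartedSpace E M] [IsManifold 𝓘(ℝ, E) ∞ M]
  {V : Type*} [NormedAddCommGroup V] [NormedSpace ℝ V]
  {A : M → Type*} [TopologicalSpace (TotalSpace V A)]
  [∀ x, AddCommGroup (A x)] [∀ x, Module ℝ (A x)] [∀ x, TopologicalSpace (A x)]
  [FiberBundle V A] [VectorBundle ℝ V A]
  {𝓐 : LieAlgebroid E V A} (Ω : SymplecticForm 𝓐)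

theorem skew (x : M) (a b : A x) : Ω.form x a b = -Ω.form x b a :=
  apply_swap_of_apply_self (Ω.alternating x) a b

theorem isRefl (x : M) : (Ω.form x).toBilinForm.IsRefl :=
  LinearMap.IsAlt.isRefl (B := (Ω.form x).toBilinForm) (Ω.alternating x)

theorem nondegenerate_toBilinForm (x : M) : (Ω.form x).toBilinForm.Nondegenerate :=
  (Ω.isRefl x).nondegenerate_iff_separatingLeft.2 (Ω.nondegenerate x)

theorem orth_eq_orthogonal (x : M) (W : Submodule ℝ (A x)) :
    Ω.orth x W = (Ω.form x).toBilinForm.orthogonal W :=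
  Submodule.ext fun _ => forall₂_congr fun _ _ => (Ω.isRefl x).eq_iff

theorem contMDiffAt_form_apply {S T : ∀ x, A x} {x : M}
    (hS : ContMDiffAt 𝓘(ℝ, E) (𝓘(ℝ, E).prod 𝓘(ℝ, V)) ∞ (fun y => TotalSpace.mk' V y (S y)) x)
    (hT : ContMDiffAt 𝓘(ℝ, E) (𝓘(ℝ, E).prod 𝓘(ℝ, V)) ∞ (fun y => TotalSpace.mk' V y (T y)) x) :
    ContMDiffAt 𝓘(ℝ, E) 𝓘(ℝ, ℝ) ∞ (fun y => Ω.form y (S y) (T y)) x := by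
  have (x : M) : ContinuousSMul ℝ (A x) :=
    (VectorBundle.continuousLinearEquivAt ℝ V A x).continuousSMul
  have hform := ContMDiffAt.clm_bundle_apply₂ (F₁ := V) (F₂ := V) (F₃ := ℝ)
    (E₃ := Bundle.Trivial M ℝ) (Ω.contMDiff x) hS hT
  simpa only [Bundle.contMDiffAt_section, Bundle.Trivial.fiberBundle_trivializationAt',
    Bundle.Trivial.trivialization_apply] using hform

variable [FiniteDimensional ℝ V]

/-- The linear isomorphism `a ↦ Ω (a, ·)` of a fibre onto its dual. -/
noncomputable def flat (x : M) : A x ≃ₗ[ℝ] Module.Dual ℝ (A x) :=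
  have : FiniteDimensional ℝ (A x) := VectorBundle.finiteDimensional ℝ V A x
  (Ω.form x).toBilinForm.toDual (Ω.nondegenerate_toBilinForm x)

theorem flat_apply (x : M) (a b : A x) : Ω.flat x a b = Ω.form x a b := by
  have : FiniteDimensional ℝ (A x) := VectorBundle.finiteDimensional ℝ V A x
  exact LinearMap.BilinForm.toDual_def (Ω.nondegenerate_toBilinForm x)

theorem form_flat_symm (x : M) (ξ : Module.Dual ℝ (A x)) (b : A x) :
    Ω.form x ((Ω.flat x).symm ξ) b = ξ b := by
  rw [← flat_apply, LinearEquiv.apply_symm_apply]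

/-- The Poisson tensor of the bracket induced by `Ω`: the composition
`T*M → A* → A → TM` of the transpose of the anchor, the inverse of `a ↦ Ω (a, ·)` and the anchor. -/
noncomputable def poissonTensor (x : M) :
    (TangentSpace 𝓘(ℝ, E) x →L[ℝ] ℝ) →ₗ[ℝ] TangentSpace 𝓘(ℝ, E) x :=
  (𝓐.anchor x).toLinearMap ∘ₗ (Ω.flat x).symm.toLinearMap ∘ₗ
    (𝓐.anchor x).toLinearMap.dualMap ∘ₗ ContinuousLinearMap.coeLM ℝ

theorem range_poissonTensor [FiniteDimensional ℝ E] (x : M) :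
    LinearMap.range (Ω.poissonTensor x) =
      (Ω.orth x (𝓐.L x)).map (𝓐.anchor x).toLinearMap := by
  have : FiniteDimensional ℝ (TangentSpace 𝓘(ℝ, E) x) := ‹FiniteDimensional ℝ E›
  have : T2Space (TangentSpace 𝓘(ℝ, E) x) := inferInstanceAs (T2Space E)
  apply le_antisymm
  · rintro _ ⟨ξ, rfl⟩
    refine ⟨(Ω.flat x).symm (ξ.comp (𝓐.anchor x)).toLinearMap, fun b hb => ?_, rfl⟩
    rw [form_flat_symm]
    exact (congrArg ξ hb).trans ξ.map_zero
  · rintro _ ⟨a, ha, rfl⟩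
    have flat_mem : Ω.flat x a ∈ LinearMap.range (𝓐.anchor x).toLinearMap.dualMap := by
      rw [LinearMap.range_dualMap_eq_dualAnnihilator_ker, Submodule.mem_dualAnnihilator]
      exact fun b hb => (Ω.flat_apply x a b).trans (ha b hb)
    obtain ⟨ξ, hξ⟩ := flat_mem
    exact ⟨LinearMap.toContinuousLinearMap ξ,
      congrArg (𝓐.anchor x) ((LinearEquiv.symm_apply_eq _).2 hξ)⟩

variable [∀ x, IsTopologicalAddGroup (A x)] [∀ x, ContinuousConstSMul ℝ (A x)]

theorem form_hamiltonian (f : C^∞⟮𝓘(ℝ, E), M; ℝ⟯) (x : M) (b : A x) :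
    Ω.form x (Ω.hamiltonian f x) b = 𝓐.d₀ f x b :=
  ((Ω.existsUnique_hamiltonian f x).choose_spec.1 b).symm

theorem eq_hamiltonian {f : C^∞⟮𝓘(ℝ, E), M; ℝ⟯} {x : M} {a : A x}
    (h : ∀ b, 𝓐.d₀ f x b = Ω.form x a b) : a = Ω.hamiltonian f x :=
  (Ω.existsUnique_hamiltonian f x).unique h fun b => (Ω.form_hamiltonian f x b).symm

theorem poissonBracket_apply (f h : C^∞⟮𝓘(ℝ, E), M; ℝ⟯) (x : M) :
    Ω.poissonBracket f h x = mvfderiv 𝓘(ℝ, E) f x (𝓐.anchor x (Ω.hamiltonian h x)) :=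
  Ω.form_hamiltonian f x _

theorem poissonBracket_skew (f h : C^∞⟮𝓘(ℝ, E), M; ℝ⟯) (x : M) :
    Ω.poissonBracket f h x = -Ω.poissonBracket h f x :=
  Ω.skew x _ _

theorem poissonTensor_mvfderiv (f : C^∞⟮𝓘(ℝ, E), M; ℝ⟯) (x : M) :
    Ω.poissonTensor x (mvfderiv 𝓘(ℝ, E) f x) = 𝓐.anchor x (Ω.hamiltonian f x) :=
  congrArg (𝓐.anchor x) (Ω.eq_hamiltonian fun b =>
    (Ω.form_flat_symm x (𝓐.d₀ f x).toLinearMap b).symm)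

theorem poissonBracket_eq_poissonTensor (f h : C^∞⟮𝓘(ℝ, E), M; ℝ⟯) (x : M) :
    Ω.poissonBracket f h x =
      mvfderiv 𝓘(ℝ, E) f x (Ω.poissonTensor x (mvfderiv 𝓘(ℝ, E) h x)) := by
  rw [poissonTensor_mvfderiv, poissonBracket_apply]

variable [ContMDiffVectorBundle ∞ V A 𝓘(ℝ, E)]

theorem contMDiff_hamiltonian (f : C^∞⟮𝓘(ℝ, E), M; ℝ⟯) :
    ContMDiff 𝓘(ℝ, E) (𝓘(ℝ, E).prod 𝓘(ℝ, V)) ∞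
      (fun x => TotalSpace.mk' V x (Ω.hamiltonian f x)) := by
  intro x₀
  let e := trivializationAt V A x₀
  have hx₀ : x₀ ∈ e.baseSet := FiberBundle.mem_baseSet_trivializationAt V A x₀
  let b := Module.finBasis ℝ V
  have contMDiffAt_frame (j) := contMDiffAt_localFrame_of_mem (I := 𝓘(ℝ, E)) ∞ e b j hx₀
  refine contMDiffAt_section_of_linearForms
    (fun j x => (Ω.form x).toBilinForm.flip (e.localFrame b j x)) (fun j t ht => ?_)
    (fun a ha => ?_) fun j => ?_
  · exact Ω.contMDiffAt_form_apply ht (contMDiffAt_frame j)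
  · have form_eq_zero : (Ω.form x₀ a).toLinearMap = 0 := (e.basisAt b hx₀).ext fun i => by
      rw [← e.localFrame_apply_of_mem_baseSet b hx₀]
      exact ha i
    exact Ω.nondegenerate x₀ a (LinearMap.congr_fun form_eq_zero)
  · exact (𝓐.contMDiffAt_d₀ f (contMDiffAt_frame j)).congr_of_eventuallyEq
      (.of_forall fun x => Ω.form_hamiltonian f x _)

/-- The Hamiltonian section as a smooth section. -/
noncomputable def hamiltonianSection (f : C^∞⟮𝓘(ℝ, E), M; ℝ⟯) : Cₛ^∞⟮𝓘(ℝ, E); V, A⟯ :=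
  ⟨Ω.hamiltonian f, Ω.contMDiff_hamiltonian f⟩

theorem contMDiff_poissonBracket (f h : C^∞⟮𝓘(ℝ, E), M; ℝ⟯) :
    ContMDiff 𝓘(ℝ, E) 𝓘(ℝ, ℝ) ∞ (Ω.poissonBracket f h) := fun x =>
  Ω.contMDiffAt_form_apply (Ω.contMDiff_hamiltonian f x) (Ω.contMDiff_hamiltonian h x)

theorem isPoissonBracket : IsPoissonBracket Ω.poissonBracket where
  contMDiff := Ω.contMDiff_poissonBracket
  add_left f₁ f₂ h := by
    ext x
    simp only [Pi.add_apply, poissonBracket_apply, ContMDiffMap.coe_add,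
      mvfderiv_add f₁.mdifferentiableAt f₂.mdifferentiableAt, add_apply]
  smul_left c f h := by
    ext x
    have smul_eq : c • (f : M → ℝ) = (fun _ : M => c) • (f : M → ℝ) := rfl
    simp only [Pi.smul_apply, poissonBracket_apply, ContMDiffMap.coe_smul]
    rw [smul_eq, mvfderiv_smul mdifferentiableAt_const f.mdifferentiableAt]
    simp [mvfderiv_const]
  skew f h := by
    ext x
    exact Ω.poissonBracket_skew f h x
  leibniz f h k := by
    ext x
    simp only [Pi.add_apply, Pi.mul_apply, Ω.poissonBracket_skew f, poissonBracket_apply,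
      ContMDiffMap.coe_mul, mvfderiv_mul h.mdifferentiableAt k.mdifferentiableAt, add_apply,
      smul_apply, smul_eq_mul]
    ring
  jacobi f h k := by
    ext x
    have hd₂ := 𝓐.d₂_of_hamiltonian Ω.alternating (S := Ω.hamiltonianSection f)
      (T := Ω.hamiltonianSection h) (U := Ω.hamiltonianSection k)
      (fun x b => (Ω.form_hamiltonian f x b).symm) (fun x b => (Ω.form_hamiltonian h x b).symm)
      (fun x b => (Ω.form_hamiltonian k x b).symm) x
    rw [Ω.closed, eq_comm, neg_add, neg_add] at hd₂
    let P (u v : C^∞⟮𝓘(ℝ, E), M; ℝ⟯) : C^∞⟮𝓘(ℝ, E), M; ℝ⟯ :=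
      ⟨Ω.poissonBracket u v, Ω.contMDiff_poissonBracket u v⟩
    change Ω.poissonBracket f (P h k) x + Ω.poissonBracket h (P k f) x +
      Ω.poissonBracket k (P f h) x = 0
    rw [poissonBracket_skew, poissonBracket_skew _ h, poissonBracket_skew _ k]
    simp only [poissonBracket_apply]
    exact hd₂

end SymplecticForm

namespace CompatibleTriple

variable {E : Type*} [NormedAddCommGroup E] [NormedSpace ℝ E]
  {M : Type*} [TopologicalSpace M] [ChartedSpace E M] [IsManifold 𝓘(ℝ, E) ∞ M]
  {V : Type*} [NormedAddCommGroup V] [NormedSpace ℝ V]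
  {A : M → Type*} [TopologicalSpace (TotalSpace V A)]
  [∀ x, AddCommGroup (A x)] [∀ x, Module ℝ (A x)] [∀ x, TopologicalSpace (A x)]
  [FiberBundle V A] [VectorBundle ℝ V A]
  {𝓐 : LieAlgebroid E V A} (τ : CompatibleTriple 𝓐)

theorem eq_zero_of_inner_self {x : M} {a : A x} (h : τ.g.inner x a a = 0) : a = 0 := by
  by_contra hne
  exact (τ.g.pos x a hne).ne' h

theorem form_J (x : M) (a b : A x) : τ.Ω.form x a (τ.J x b) = -τ.g.inner x a b := by
  rw [τ.Ω_eq, τ.J_J, map_neg]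

/-- The orthogonal complement of a subspace of a fibre for the metric. -/
noncomputable def metricOrth (x : M) (W : Submodule ℝ (A x)) : Submodule ℝ (A x) :=
  (τ.g.inner x).toBilinForm.orthogonal W

theorem mem_metricOrth {x : M} {W : Submodule ℝ (A x)} {a : A x} :
    a ∈ τ.metricOrth x W ↔ ∀ b ∈ W, τ.g.inner x a b = 0 :=
  forall₂_congr fun b _ => by rw [τ.g.symm x a b]; rfl

theorem disjoint_metricOrth (x : M) (W : Submodule ℝ (A x)) : Disjoint W (τ.metricOrth x W) :=
  Submodule.disjoint_def.2 fun a ha ha' => τ.eq_zero_of_inner_self (ha' a ha)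

theorem L₂_eq (x : M) : τ.L₂ x = τ.metricOrth x (τ.L₁ x) ⊓ 𝓐.L x := by
  ext a
  rw [Submodule.mem_inf, mem_metricOrth]
  exact and_comm

theorem E₂_eq (x : M) : τ.E₂ x = τ.metricOrth x (τ.L₁ x) ⊓ τ.Ω.orth x (𝓐.L x) := by
  ext a
  rw [Submodule.mem_inf, mem_metricOrth]
  refine ⟨fun ha => ⟨fun m hm => ?_, fun b hb => ha b (Submodule.mem_sup_left hb)⟩, ?_⟩
  · rw [← neg_eq_zero, ← τ.form_J]
    exact ha _ (Submodule.mem_sup_right ⟨m, hm, rfl⟩)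
  · rintro ⟨h_inner, h_form⟩ b hb
    obtain ⟨l, hl, _, ⟨m, hm, rfl⟩, rfl⟩ := Submodule.mem_sup.1 hb
    rw [map_add, h_form l hl, zero_add]
    exact (τ.form_J x a m).trans (neg_eq_zero.2 (h_inner m hm))

theorem eq_zero_of_J_add_mem_L {x : M} {m e : A x} (hm : m ∈ τ.L₁ x) (he : e ∈ τ.E₂ x)
    (hL : τ.J x m + e ∈ 𝓐.L x) : m = 0 ∧ e = 0 := by
  rw [E₂_eq] at he
  have hm_zero : m = 0 := by
    have h_form : τ.Ω.form x m (τ.J x m + e) = 0 := hm.2 _ hL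
    rw [map_add, τ.form_J, τ.Ω.skew x m e, he.2 m hm.1, neg_zero, add_zero, neg_eq_zero] at h_form
    exact τ.eq_zero_of_inner_self h_form
  subst hm_zero
  rw [map_zero, zero_add] at hL
  have he_L₁ : e ∈ τ.L₁ x := ⟨hL, he.2⟩
  exact ⟨rfl, Submodule.disjoint_def.1 (τ.disjoint_metricOrth x (τ.L₁ x)) e he_L₁ he.1⟩

variable [FiniteDimensional ℝ V]

theorem isCompl_metricOrth (x : M) (W : Submodule ℝ (A x)) : IsCompl W (τ.metricOrth x W) :=
  have : FiniteDimensional ℝ (A x) := VectorBundle.finiteDimensional ℝ V A x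
  (LinearMap.BilinForm.isCompl_orthogonal_iff_disjoint (B := (τ.g.inner x).toBilinForm)
    fun a b (h : τ.g.inner x a b = 0) => (τ.g.symm x b a).trans h).2 (τ.disjoint_metricOrth x W)

theorem L₁_sup_L₂ (x : M) : τ.L₁ x ⊔ τ.L₂ x = 𝓐.L x := by
  have L₁_le : τ.L₁ x ≤ 𝓐.L x := inf_le_left
  rw [L₂_eq, ← sup_inf_assoc_of_le _ L₁_le, (τ.isCompl_metricOrth x _).sup_eq_top, top_inf_eq]

theorem E₂_sup_L₁ (x : M) : τ.E₂ x ⊔ τ.L₁ x = τ.Ω.orth x (𝓐.L x) := by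
  have L₁_le : τ.L₁ x ≤ τ.Ω.orth x (𝓐.L x) := inf_le_right
  rw [E₂_eq, sup_comm, ← sup_inf_assoc_of_le _ L₁_le, (τ.isCompl_metricOrth x _).sup_eq_top,
    top_inf_eq]

theorem isCompl_E_L (x : M) : IsCompl (τ.E₁ x ⊔ τ.E₂ x) (τ.L₁ x ⊔ τ.L₂ x) := by
  have : FiniteDimensional ℝ (A x) := VectorBundle.finiteDimensional ℝ V A x
  rw [L₁_sup_L₂]
  constructor
  · refine Submodule.disjoint_def.2 fun a ha haL => ?_
    obtain ⟨_, ⟨m, hm, rfl⟩, e, he, rfl⟩ := Submodule.mem_sup.1 ha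
    obtain ⟨rfl, rfl⟩ := τ.eq_zero_of_J_add_mem_L hm he haL
    simp
  · have disjoint_E₂ : Disjoint (𝓐.L x ⊔ τ.E₁ x) (τ.E₂ x) := by
      refine Submodule.disjoint_def.2 fun e he he₂ => ?_
      obtain ⟨l, hl, _, ⟨m, hm, rfl⟩, rfl⟩ := Submodule.mem_sup.1 he
      exact (τ.eq_zero_of_J_add_mem_L (neg_mem hm) he₂ (by simpa using hl)).2
    rw [E₂, τ.Ω.orth_eq_orthogonal] at disjoint_E₂
    have sup_E₂ := ((LinearMap.BilinForm.isCompl_orthogonal_iff_disjoint (τ.Ω.isRefl x)).2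
      disjoint_E₂).sup_eq_top
    rw [← τ.Ω.orth_eq_orthogonal, ← E₂] at sup_E₂
    rw [codisjoint_iff, ← sup_E₂]
    ac_rfl

theorem Λ_eq_map_orth (x : M) : τ.Λ x = (τ.Ω.orth x (𝓐.L x)).map (𝓐.anchor x).toLinearMap := by
  rw [Λ, E₂_sup_L₁]

theorem range_poissonTensor [FiniteDimensional ℝ E] (x : M) :
    LinearMap.range (τ.Ω.poissonTensor x) = τ.Λ x := by
  rw [τ.Ω.range_poissonTensor, τ.Λ_eq_map_orth]

end CompatibleTriple

section PathSpace

open Set Filter Topology unitInterval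

universe u

variable {K : Type*} [TopologicalSpace K] [CompactSpace K]
  {E F : Type u} [NormedAddCommGroup E] [NormedSpace ℝ E] [NormedAddCommGroup F] [NormedSpace ℝ F]

set_option synthInstance.maxHeartbeats 200000 in
-- Finding the norm on `C(K, E →L[ℝ] F)` takes a long instance search.
variable (K E F) in
/-- Pointwise application of a family of continuous linear maps. -/
noncomputable def pointwiseApply : C(K, E →L[ℝ] F) →L[ℝ] C(K, E) →L[ℝ] C(K, F) :=
  LinearMap.mkContinuous₂
    (LinearMap.mk₂ ℝ
      (fun (T : C(K, E →L[ℝ] F)) (u : C(K, E)) => (⟨fun s => T s (u s), by fun_prop⟩ : C(K, F)))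
      (fun _ _ _ => rfl) (fun _ _ _ => rfl) (fun _ _ _ => by ext; simp)
      (fun _ _ _ => by ext; simp)) 1 fun T u => by
    rw [one_mul, ContinuousMap.norm_le _ (by positivity)]
    exact fun s => (T s).le_of_opNorm_le_of_le (T.norm_coe_le_norm s) (u.norm_coe_le_norm s)

@[simp]
theorem pointwiseApply_apply (T : C(K, E →L[ℝ] F)) (u : C(K, E)) (s : K) :
    pointwiseApply K E F T u s = T s (u s) := rfl

variable (K E) in
/-- The inclusion of `E` into the continuous maps `K → E` as the constant maps. -/
noncomputable def constCLM : E →L[ℝ] C(K, E) where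
  toFun := ContinuousMap.const K
  map_add' _ _ := rfl
  map_smul' _ _ := rfl
  cont := ContinuousMap.continuous_const'

omit [CompactSpace K] in
@[simp]
theorem constCLM_apply (x : E) (s : K) : constCLM K E x s = x := rfl

theorem hasFDerivAt_comp_left {f : C(E, F)} {f' : C(E, E →L[ℝ] F)}
    (hf : ∀ x, HasFDerivAt f (f' x) x) (γ : C(K, E)) :
    HasFDerivAt (fun γ : C(K, E) => f.comp γ) (pointwiseApply K E F (f'.comp γ)) γ := by
  rw [hasFDerivAt_iff_isLittleO, Asymptotics.isLittleO_iff]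
  intro ε hε
  have hunif := (isCompact_range γ.continuous).uniformContinuousAt_of_continuousAt f'
    (fun _ _ => f'.continuous.continuousAt) (Metric.dist_mem_uniformity hε)
  obtain ⟨δ, hδ, hsub⟩ := Metric.mem_uniformity_dist.1 hunif
  filter_upwards [Metric.ball_mem_nhds γ hδ] with γ' hγ'
  rw [ContinuousMap.norm_le _ (by positivity)]
  intro s
  have hdist : γ' s ∈ Metric.ball (γ s) δ := (ContinuousMap.dist_apply_le_dist s).trans_lt hγ'
  have hbound : ∀ z ∈ Metric.ball (γ s) δ, ‖f' z - f' (γ s)‖ ≤ ε := fun z hz => by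
    rw [← dist_eq_norm, dist_comm]
    exact le_of_lt (hsub (by rwa [dist_comm]) ⟨s, rfl⟩)
  refine ((convex_ball (γ s) δ).norm_image_sub_le_of_norm_hasFDerivWithin_le'
    (fun z _ => (hf z).hasFDerivWithinAt) hbound (Metric.mem_ball_self hδ) hdist).trans ?_
  gcongr
  exact (γ' - γ).norm_coe_le_norm s

set_option synthInstance.maxHeartbeats 200000 in
-- Finding the norm on `C(K, E →L[ℝ] F)` takes a long instance search.
theorem contDiff_nat_comp_left (n : ℕ) :
    ∀ {F : Type u} [NormedAddCommGroup F] [NormedSpace ℝ F] {f : C(E, F)},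
      ContDiff ℝ n f → ContDiff ℝ n (fun γ : C(K, E) => f.comp γ) := by
  induction n with
  | zero => exact fun _ => contDiff_zero.2 (ContinuousMap.continuous_postcomp _)
  | succ n ih =>
    intro F _ _ f hf
    push_cast at hf ⊢
    obtain ⟨f', hf', h⟩ := contDiff_succ_iff_hasFDerivAt.1 hf
    refine contDiff_succ_iff_hasFDerivAt.2
      ⟨_, ?_, hasFDerivAt_comp_left (f' := ⟨f', hf'.continuous⟩) h⟩
    exact (pointwiseApply K E F).contDiff.comp (ih (f := ⟨f', hf'.continuous⟩) hf')

theorem contDiff_comp_left {f : C(E, F)} (hf : ContDiff ℝ ∞ f) :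
    ContDiff ℝ ∞ (fun γ : C(K, E) => f.comp γ) :=
  contDiff_infty.2 fun n => contDiff_nat_comp_left n (contDiff_infty.1 hf n)

section Primitive

omit [NormedSpace ℝ E] in
theorem continuous_IccExtend (u : C(I, E)) : Continuous (IccExtend (zero_le_one' ℝ) u) :=
  u.continuous.Icc_extend'

variable (E)

/-- The primitive vanishing at `0` of a continuous path. -/
noncomputable def pathPrimitive : C(I, E) →L[ℝ] C(I, E) :=
  LinearMap.mkContinuous
    { toFun := fun u => ⟨fun s => ∫ r in (0 : ℝ)..s, IccExtend (zero_le_one' ℝ) u r,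
        (intervalIntegral.continuous_primitive
          (fun _ _ => (continuous_IccExtend u).intervalIntegrable _ _) 0).comp
          continuous_subtype_val⟩
      map_add' := fun u v => by
        ext s
        exact intervalIntegral.integral_add ((continuous_IccExtend u).intervalIntegrable _ _)
          ((continuous_IccExtend v).intervalIntegrable _ _)
      map_smul' := fun c u => by
        ext s
        exact intervalIntegral.integral_smul c _ } 1 fun u => by
    rw [one_mul, ContinuousMap.norm_le _ (norm_nonneg u)]
    intro s
    refine (intervalIntegral.norm_integral_le_of_norm_le_const (C := ‖u‖)
      fun r _ => u.norm_coe_le_norm _).trans ?_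
    rw [sub_zero, abs_of_nonneg s.2.1]
    exact mul_le_of_le_one_right (norm_nonneg _) s.2.2

variable {E}

theorem pathPrimitive_zero (u : C(I, E)) : pathPrimitive E u 0 = 0 :=
  intervalIntegral.integral_same

theorem hasDerivWithinAt_IccExtend_of_eq_primitive [CompleteSpace E] {γ u : C(I, E)} {c : E}
    (h : γ = constCLM I E c + pathPrimitive E u) {s : ℝ} (hs : s ∈ Icc (0 : ℝ) 1) :
    HasDerivWithinAt (IccExtend (zero_le_one' ℝ) γ) (IccExtend (zero_le_one' ℝ) u s)
      (Icc 0 1) s := by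
  have hu := continuous_IccExtend u
  refine HasDerivWithinAt.congr_of_mem ((intervalIntegral.integral_hasDerivAt_right
    (hu.intervalIntegrable 0 s) (hu.stronglyMeasurableAtFilter _ _)
    hu.continuousAt).const_add c).hasDerivWithinAt (fun t ht => ?_) hs
  rw [IccExtend_of_mem _ _ ht, h]
  rfl

theorem pathPrimitive_constCLM [CompleteSpace E] (x : E) :
    pathPrimitive E (constCLM I E x) 1 = x := by
  change ∫ _ in (0 : ℝ)..(1 : ℝ), x = x
  simp

end Primitive

end PathSpace

section ImplicitFunction

open Filter Topology

variable {E₁ E₂ F : Type*} [NormedAddCommGroup E₁] [NormedSpace ℝ E₁] [CompleteSpace E₁]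
  [NormedAddCommGroup E₂] [NormedSpace ℝ E₂] [CompleteSpace E₂]
  [NormedAddCommGroup F] [NormedSpace ℝ F] [CompleteSpace F]

/- Near the base point the implicit functions based at neighbouring points have the same germ, so
smoothness at their base points, which is all Mathlib provides, spreads to a neighbourhood. -/
theorem eventually_contDiffAt_implicitFunction {f : E₁ × E₂ → F} (hf : ContDiff ℝ ∞ f)
    {u : E₁ × E₂} (hu : (fderiv ℝ f u ∘L .inr ℝ E₁ E₂).IsInvertible) :
    ∀ᶠ x in 𝓝 u.1, ContDiffAt ℝ ∞ (hf.contDiffAt.implicitFunction (by simp) hu) x := by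
  have hn : (∞ : ℕ∞ω) ≠ 0 := by simp
  set ψ := hf.contDiffAt.implicitFunction hn hu
  have hψu : ψ u.1 = u.2 := hf.contDiffAt.implicitFunction_apply_self hn hu
  have hgraph : Tendsto (fun x => (x, ψ x)) (𝓝 u.1) (𝓝 u) := by
    have := (continuousAt_id (x := u.1)).prodMk
      (hf.contDiffAt.contDiffAt_implicitFunction hn hu).continuousAt
    change Tendsto (fun x => (x, ψ x)) (𝓝 u.1) (𝓝 (u.1, ψ u.1)) at this
    rwa [hψu] at this
  have hinv : ∀ᶠ v in 𝓝 u, (fderiv ℝ f v ∘L .inr ℝ E₁ E₂).IsInvertible := by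
    obtain ⟨e, he⟩ := id hu
    have hc : Continuous fun v => fderiv ℝ f v ∘L .inr ℝ E₁ E₂ :=
      (hf.continuous_fderiv hn).clm_comp continuous_const
    exact hc.continuousAt.eventually (by beta_reduce; rw [← he]; exact e.nhds)
  filter_upwards [hgraph.eventually hinv,
    hgraph.eventually
      (hf.contDiffAt.eventually_apply_eq_iff_implicitFunction hn hu).eventually_nhds,
    hf.contDiffAt.eventually_apply_implicitFunction hn hu] with x hx hψ hfx
  have hx' := hf.contDiffAt.contDiffAt_implicitFunction hn hx
  refine hx'.congr_of_eventuallyEq ?_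
  have hgraph' := (continuousAt_id (x := x)).prodMk hx'.continuousAt
  rw [ContinuousAt, hf.contDiffAt.implicitFunction_apply_self hn hx] at hgraph'
  filter_upwards [hgraph'.eventually hψ, hf.contDiffAt.eventually_apply_implicitFunction hn hx]
    with y hy hfy
  exact hy.1 (hfy.trans hfx)

end ImplicitFunction

section SolutionFamilies

open Set Filter Topology unitInterval

universe u

variable {E F : Type u} [NormedAddCommGroup E] [NormedSpace ℝ E]
  [NormedAddCommGroup F] [NormedSpace ℝ F]

/-- The Picard operator of the initial value problem `γ' = B(γ) ξ`, `γ(0) = x₀` on `[0, 1]`: its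
fixed points are the solutions. -/
noncomputable def picard (B : C(E, F →L[ℝ] E)) (x₀ : E) (ξ : F) (γ : C(I, E)) : C(I, E) :=
  constCLM I E x₀ + pathPrimitive E (pointwiseApply I F E (B.comp γ) (constCLM I F ξ))

theorem picard_zero_param (B : C(E, F →L[ℝ] E)) (x₀ : E) (γ : C(I, E)) :
    picard B x₀ 0 γ = constCLM I E x₀ := by
  simp [picard]

theorem picard_apply_zero (B : C(E, F →L[ℝ] E)) (x₀ : E) (ξ : F) (γ : C(I, E)) :
    picard B x₀ ξ γ 0 = x₀ := by
  simp [picard, pathPrimitive_zero]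

theorem contDiff_picard {B : C(E, F →L[ℝ] E)} (hB : ContDiff ℝ ∞ B) (x₀ : E) :
    ContDiff ℝ ∞ fun p : F × C(I, E) => picard B x₀ p.1 p.2 := by
  have hA : ContDiff ℝ ∞ fun p : F × C(I, E) => pointwiseApply I F E (B.comp p.2) :=
    ContDiff.comp (g := pointwiseApply I F E) (ContinuousLinearMap.contDiff _)
      ((contDiff_comp_left hB).comp contDiff_snd)
  exact contDiff_const.add ((pathPrimitive E).contDiff.comp
    (hA.clm_apply ((constCLM I F).contDiff.comp contDiff_fst)))

theorem exists_contDiffAt_picard_fixedPoint [CompleteSpace E] [CompleteSpace F]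
    {B : C(E, F →L[ℝ] E)} (hB : ContDiff ℝ ∞ B) (x₀ : E) :
    ∃ Γ : F → C(I, E), Γ 0 = constCLM I E x₀ ∧
      ∀ᶠ ξ in 𝓝 (0 : F), ContDiffAt ℝ ∞ Γ ξ ∧ Γ ξ = picard B x₀ ξ (Γ ξ) := by
  let H : F × C(I, E) → C(I, E) := fun p => p.2 - picard B x₀ p.1 p.2
  let p₀ : F × C(I, E) := (0, constCLM I E x₀)
  have hH : ContDiff ℝ ∞ H := contDiff_snd.sub (contDiff_picard hB x₀)
  have hH₀ : H p₀ = 0 := by simp [H, p₀, picard_zero_param]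
  have hpartial : fderiv ℝ H p₀ ∘L .inr ℝ F C(I, E) = .id ℝ C(I, E) := by
    have h : HasFDerivAt (fun γ => H (0, γ)) (.id ℝ C(I, E)) (constCLM I E x₀) := by
      simp only [H, picard_zero_param]
      exact (hasFDerivAt_id _).sub_const _
    exact (HasFDerivAt.comp (g := H) _ (hH.differentiable (by simp) p₀).hasFDerivAt
      (hasFDerivAt_prodMk_right _ _)).unique h
  have hinv : (fderiv ℝ H p₀ ∘L .inr ℝ F C(I, E)).IsInvertible := by
    rw [hpartial]
    exact ⟨.refl ℝ C(I, E), rfl⟩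
  refine ⟨hH.contDiffAt.implicitFunction (by simp) hinv,
    hH.contDiffAt.implicitFunction_apply_self (by simp) hinv, ?_⟩
  filter_upwards [eventually_contDiffAt_implicitFunction hH hinv,
    hH.contDiffAt.eventually_apply_implicitFunction (by simp) hinv] with ξ hsmooth hfix
  exact ⟨hsmooth, sub_eq_zero.1 (hfix.trans hH₀)⟩

/-- The velocity of the variation `δ` of a solution `γ` of `γ' = B(γ) ξ` when `ξ` varies in the
direction `η`. -/
noncomputable def linearizedVelocity {B : C(E, F →L[ℝ] E)} (hB : ContDiff ℝ ∞ B) (ξ η : F)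
    (γ δ : C(I, E)) : C(I, E) where
  toFun s := fderiv ℝ B (γ s) (δ s) ξ + B (γ s) η
  continuous_toFun := by
    have := hB.continuous_fderiv (by simp)
    fun_prop

theorem fderiv_picard_fixedPoint [CompleteSpace E] {B : C(E, F →L[ℝ] E)} (hB : ContDiff ℝ ∞ B)
    {x₀ : E} {Γ : F → C(I, E)} {ξ : F} (hΓ : DifferentiableAt ℝ Γ ξ)
    (hfix : ∀ᶠ ξ in 𝓝 ξ, Γ ξ = picard B x₀ ξ (Γ ξ)) (η : F) :
    fderiv ℝ Γ ξ η =
      constCLM I E 0 + pathPrimitive E (linearizedVelocity hB ξ η (Γ ξ) (fderiv ℝ Γ ξ η)) := by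
  let B' : C(E, E →L[ℝ] F →L[ℝ] E) := ⟨fderiv ℝ B, hB.continuous_fderiv (by simp)⟩
  have hB' : ∀ x, HasFDerivAt B (B' x) x := fun x => (hB.differentiable (by simp) x).hasFDerivAt
  have hcomp := HasFDerivAt.comp (g := pointwiseApply I F E) ξ (ContinuousLinearMap.hasFDerivAt _)
    ((hasFDerivAt_comp_left hB' (Γ ξ)).comp ξ hΓ.hasFDerivAt)
  have hpicard := ((pathPrimitive E).hasFDerivAt.comp ξ
    (hcomp.clm_apply (constCLM I F).hasFDerivAt)).const_add (constCLM I E x₀)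
  have h := DFunLike.congr_fun
    ((hΓ.hasFDerivAt.congr_of_eventuallyEq (hfix.mono fun _ h => h.symm)).unique hpicard) η
  refine h.trans ?_
  rw [map_zero, zero_add]
  refine congrArg (pathPrimitive E) ?_
  ext s
  exact add_comm (B (Γ ξ s) η) (fderiv ℝ B (Γ ξ s) (fderiv ℝ Γ ξ η s) ξ)

end SolutionFamilies

section LinearODE

open Set Filter Topology

variable {G : Type*} [NormedAddCommGroup G] [NormedSpace ℝ G]

theorem exists_solution_affine_ode [CompleteSpace G] {A : ℝ → G →L[ℝ] G} {b : ℝ → G} {c : ℝ}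
    (hA : ContinuousOn A (Icc 0 1)) (hb : ContinuousOn b (Icc 0 1))
    (hA2 : ∀ s ∈ Icc (0 : ℝ) 1, ‖A s‖ ≤ 1 / 2) (hbc : ∀ s ∈ Icc (0 : ℝ) 1, ‖b s‖ ≤ c) (y₀ : G) :
    ∃ y : ℝ → G, y 0 = y₀ ∧
      ∀ s ∈ Icc (0 : ℝ) 1, HasDerivWithinAt y (A s (y s) + b s) (Icc 0 1) s := by
  have hc : 0 ≤ c := (norm_nonneg _).trans (hbc 0 (by simp))
  let r : NNReal := ⟨‖y₀‖ + 2 * c, by positivity⟩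
  have hPL : IsPicardLindelof (fun s y => A s y + b s) (⟨0, by simp⟩ : Icc (0 : ℝ) 1) y₀ r 0 r
      1 := by
    refine ⟨fun s hs => ?_, fun y _ => (hA.clm_apply continuousOn_const).add hb,
      fun s hs y hy => ?_, ?_⟩
    · refine (LipschitzWith.of_dist_le_mul fun y z => ?_).lipschitzOnWith
      rw [dist_add_right, dist_eq_norm, dist_eq_norm, ← map_sub, NNReal.coe_one, one_mul]
      refine ((A s).le_of_opNorm_le (hA2 s hs) _).trans ?_
      linarith [norm_nonneg (y - z)]
    · have hy' : ‖y‖ ≤ ‖y₀‖ + (‖y₀‖ + 2 * c) := norm_le_of_mem_closedBall hy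
      change ‖A s y + b s‖ ≤ ‖y₀‖ + 2 * c
      linarith [(A s).le_of_opNorm_le (hA2 s hs) y, norm_add_le (A s y) (b s), hbc s hs]
    · simp
  exact hPL.exists_eq_forall_mem_Icc_hasDerivWithinAt₀

theorem eq_zero_of_norm_deriv_le {w w' : ℝ → G} {K : ℝ}
    (hw : ∀ s ∈ Icc (0 : ℝ) 1, HasDerivWithinAt w (w' s) (Icc 0 1) s)
    (hK : ∀ s ∈ Icc (0 : ℝ) 1, ‖w' s‖ ≤ K * ‖w s‖) (h0 : w 0 = 0) : w 1 = 0 :=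
  eq_zero_of_abs_deriv_le_mul_abs_self_of_eq_zero_right
    (fun s hs => (hw s hs).continuousWithinAt)
    (fun s hs => (hw s ⟨hs.1, hs.2.le⟩).mono_of_mem_nhdsWithin (Icc_mem_nhdsGE_of_mem hs)) h0
    (fun s hs => hK s ⟨hs.1, hs.2.le⟩) 1 (by simp)

end LinearODE

section HamiltonianTransport

open Set Filter Topology

variable {E F : Type*} [NormedAddCommGroup E] [NormedSpace ℝ E]
  [NormedAddCommGroup F] [NormedSpace ℝ F]

/-- A contravariant action of the endomorphisms of `E` on `F` by contractions. The example to have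
in mind is the transposition of endomorphisms, acting on the dual space `F` of `E`. -/
structure Transposition (E F : Type*) [NormedAddCommGroup E] [NormedSpace ℝ E]
    [NormedAddCommGroup F] [NormedSpace ℝ F] where
  /-- The underlying linear map. -/
  toCLM : (E →L[ℝ] E) →L[ℝ] F →L[ℝ] F
  norm_le : ∀ T, ‖toCLM T‖ ≤ ‖T‖
  map_id : toCLM (.id ℝ E) = .id ℝ F
  map_comp : ∀ S T : E →L[ℝ] E, toCLM (S ∘L T) = toCLM T ∘L toCLM S

variable {D : Transposition E F} {B : E → F →L[ℝ] E} {γ : ℝ → E} {ξ : F}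

/-- The Jacobi identity at `z` for a field of linear maps `B z : F → E`, where `F` is the dual of
`E`. With `X_ξ = B ξ` the Hamiltonian vector field of the linear function `ξ`, it says that
`[X_ξ, X_ζ]` is the Hamiltonian vector field of the function `⟨ζ, X_ξ⟩`. -/
def Transposition.JacobiAt (D : Transposition E F) (B : E → F →L[ℝ] E) (z : E) : Prop :=
  ∀ ξ ζ, fderiv ℝ B z (B z ξ) ζ =
    fderiv ℝ B z (B z ζ) ξ + B z (D.toCLM ((fderiv ℝ B z).flip ξ) ζ)

theorem continuousOn_flip_fderiv (hB : ContDiff ℝ ∞ B) {s : Set ℝ} (hγ : ContinuousOn γ s)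
    (ξ : F) : ContinuousOn (fun s => (fderiv ℝ B (γ s)).flip ξ) s :=
  ((ContinuousLinearMap.flipₗᵢ ℝ E F E).continuous.clm_apply
    continuous_const).comp_continuousOn ((hB.continuous_fderiv (by simp)).comp_continuousOn hγ)

theorem hasDerivWithinAt_tensor_of_hamiltonian_curve {t : Set ℝ} {s : ℝ} (hB : ContDiff ℝ ∞ B)
    (hJ : D.JacobiAt B (γ s)) (hγ : HasDerivWithinAt γ (B (γ s) ξ) t s) :
    HasDerivWithinAt (fun s => B (γ s))
      ((fderiv ℝ B (γ s)).flip ξ ∘L B (γ s) +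
        B (γ s) ∘L D.toCLM ((fderiv ℝ B (γ s)).flip ξ)) t s := by
  refine ((hB.differentiable (by simp) (γ s)).hasFDerivAt.comp_hasDerivWithinAt s hγ).congr_deriv ?_
  ext1 ζ
  exact hJ ξ ζ

theorem hasDerivWithinAt_conj {A Q : ℝ → E →L[ℝ] E} {t : Set ℝ} {s : ℝ}
    (hQ : HasDerivWithinAt Q (A s ∘L Q s) t s) (C : F →L[ℝ] E) :
    HasDerivWithinAt (fun s => (Q s ∘L C) ∘L D.toCLM (Q s))
      (A s ∘L ((Q s ∘L C) ∘L D.toCLM (Q s)) +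
        ((Q s ∘L C) ∘L D.toCLM (Q s)) ∘L D.toCLM (A s)) t s := by
  refine ((hQ.clm_comp (hasDerivWithinAt_const s t C)).clm_comp
    (D.toCLM.hasFDerivAt.comp_hasDerivWithinAt s hQ)).congr_deriv ?_
  ext1 ζ
  simp [D.map_comp]

/-- Variation of constants: if `α' = -Aᵀ α + η` with `A = DX_ξ`, then `B(γ) α` solves the same
linearized equation as `ψ`. -/
theorem exists_eq_apply_of_linearized [CompleteSpace F] (hB : ContDiff ℝ ∞ B)
    (hγ : ∀ s ∈ Icc (0 : ℝ) 1, HasDerivWithinAt γ (B (γ s) ξ) (Icc 0 1) s)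
    (hJ : ∀ s ∈ Icc (0 : ℝ) 1, D.JacobiAt B (γ s))
    (hA : ∀ s ∈ Icc (0 : ℝ) 1, ‖(fderiv ℝ B (γ s)).flip ξ‖ ≤ 1 / 2)
    {ψ : ℝ → E} {η : F} (hψ0 : ψ 0 = 0)
    (hψ : ∀ s ∈ Icc (0 : ℝ) 1,
      HasDerivWithinAt ψ (fderiv ℝ B (γ s) (ψ s) ξ + B (γ s) η) (Icc 0 1) s) :
    ∃ α, ψ 1 = B (γ 1) α := by
  set A : ℝ → E →L[ℝ] E := fun s => (fderiv ℝ B (γ s)).flip ξ with hA_def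
  obtain ⟨α, hα0, hα⟩ := exists_solution_affine_ode
    (A := fun s => -D.toCLM (A s)) (b := fun _ => η) (c := ‖η‖)
    (D.toCLM.continuous.comp_continuousOn
      (continuousOn_flip_fderiv hB (fun s hs => (hγ s hs).continuousWithinAt) ξ)).neg
    continuousOn_const
    (fun s hs => (norm_neg _).trans_le ((D.norm_le _).trans (hA s hs)))
    (fun _ _ => le_rfl) 0
  have hderiv : ∀ s ∈ Icc (0 : ℝ) 1, HasDerivWithinAt (fun s => ψ s - B (γ s) (α s))
      (A s (ψ s - B (γ s) (α s))) (Icc 0 1) s := fun s hs => by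
    refine ((hψ s hs).sub ((hasDerivWithinAt_tensor_of_hamiltonian_curve hB (hJ s hs)
      (hγ s hs)).clm_apply (hα s hs))).congr_deriv ?_
    simp only [hA_def, add_apply, neg_apply, ContinuousLinearMap.comp_apply,
      ContinuousLinearMap.flip_apply, map_sub, map_add, map_neg]
    abel
  exact ⟨α 1, sub_eq_zero.1 (eq_zero_of_norm_deriv_le hderiv
    (fun s hs => ContinuousLinearMap.le_of_opNorm_le _ (hA s hs) _) (by simp [hψ0, hα0]))⟩

/-- Both sides solve `Y' = A Y + Y Aᵀ` with `A = DX_ξ`, provided `Q' = A Q`. -/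
theorem exists_conj_of_hamiltonian_curve [CompleteSpace E] (hB : ContDiff ℝ ∞ B)
    (hγ : ∀ s ∈ Icc (0 : ℝ) 1, HasDerivWithinAt γ (B (γ s) ξ) (Icc 0 1) s)
    (hJ : ∀ s ∈ Icc (0 : ℝ) 1, D.JacobiAt B (γ s))
    (hA : ∀ s ∈ Icc (0 : ℝ) 1, ‖(fderiv ℝ B (γ s)).flip ξ‖ ≤ 1 / 2) :
    ∃ Q : E →L[ℝ] E, B (γ 1) = (Q ∘L B (γ 0)) ∘L D.toCLM Q := by
  set A : ℝ → E →L[ℝ] E := fun s => (fderiv ℝ B (γ s)).flip ξ with hA_def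
  obtain ⟨Q, hQ0, hQ⟩ := exists_solution_affine_ode
    (A := fun s => ContinuousLinearMap.compL ℝ E E E (A s)) (b := fun _ => 0) (c := 0)
    ((ContinuousLinearMap.compL ℝ E E E).continuous.comp_continuousOn
      (continuousOn_flip_fderiv hB (fun s hs => (hγ s hs).continuousWithinAt) ξ))
    continuousOn_const
    (fun s hs => (ContinuousLinearMap.opNorm_le_bound _ (norm_nonneg _) fun T =>
      (A s).opNorm_comp_le T).trans (hA s hs)) (by simp) (.id ℝ E)
  let W : ℝ → F →L[ℝ] E := fun s => B (γ s) - (Q s ∘L B (γ 0)) ∘L D.toCLM (Q s)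
  have hderiv : ∀ s ∈ Icc (0 : ℝ) 1, HasDerivWithinAt W
      (A s ∘L W s + W s ∘L D.toCLM (A s)) (Icc 0 1) s := fun s hs => by
    refine ((hasDerivWithinAt_tensor_of_hamiltonian_curve hB (hJ s hs) (hγ s hs)).sub
      (hasDerivWithinAt_conj (A := A) ((hQ s hs).congr_deriv (add_zero _)) (B (γ 0)))).congr_deriv
      ?_
    simp only [W, ContinuousLinearMap.comp_sub, ContinuousLinearMap.sub_comp, hA_def]
    abel
  have hbound : ∀ s ∈ Icc (0 : ℝ) 1, ‖A s ∘L W s + W s ∘L D.toCLM (A s)‖ ≤ 1 * ‖W s‖ :=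
    fun s hs => by
    have hT : ‖D.toCLM (A s)‖ ≤ 1 / 2 := (D.norm_le _).trans (hA s hs)
    calc _ ≤ ‖A s‖ * ‖W s‖ + ‖W s‖ * ‖D.toCLM (A s)‖ :=
          (norm_add_le _ _).trans (add_le_add ((A s).opNorm_comp_le _) ((W s).opNorm_comp_le _))
      _ ≤ 1 / 2 * ‖W s‖ + ‖W s‖ * (1 / 2) := by gcongr; exact hA s hs
      _ = 1 * ‖W s‖ := by ring
  refine ⟨Q 1, sub_eq_zero.1 (eq_zero_of_norm_deriv_le hderiv hbound ?_)⟩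
  ext1 ζ
  simp [W, hQ0, D.map_id]

end HamiltonianTransport

section TimeOneMap

open Set Filter Topology unitInterval

universe u

variable {E F : Type u} [NormedAddCommGroup E] [NormedSpace ℝ E]
  [NormedAddCommGroup F] [NormedSpace ℝ F] {D : Transposition E F} {B : C(E, F →L[ℝ] E)}
  {x₀ : E} {ξ : F} {Γ : F → C(I, E)}

theorem hasDerivWithinAt_picard_fixedPoint [CompleteSpace E] {γ : C(I, E)}
    (hγ : γ = picard B x₀ ξ γ) {s : ℝ} (hs : s ∈ Icc (0 : ℝ) 1) :
    HasDerivWithinAt (IccExtend (zero_le_one' ℝ) γ) (B (IccExtend (zero_le_one' ℝ) γ s) ξ)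
      (Icc 0 1) s :=
  hasDerivWithinAt_IccExtend_of_eq_primitive hγ hs

theorem fderiv_apply_one (hΓ : DifferentiableAt ℝ Γ ξ) (η : F) :
    fderiv ℝ (fun ξ => Γ ξ 1) ξ η = fderiv ℝ Γ ξ η 1 := by
  let ev : C(I, E) →L[ℝ] E := ContinuousMap.evalCLM ℝ (1 : I)
  exact DFunLike.congr_fun (ev.hasFDerivAt.comp ξ hΓ.hasFDerivAt).fderiv η

theorem fderiv_apply_one_zero [CompleteSpace E] (hB : ContDiff ℝ ∞ B)
    (hΓ₀ : Γ 0 = constCLM I E x₀) (hΓ : DifferentiableAt ℝ Γ 0)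
    (hfix : ∀ᶠ ξ in 𝓝 0, Γ ξ = picard B x₀ ξ (Γ ξ)) :
    fderiv ℝ (fun ξ => Γ ξ 1) 0 = B x₀ := by
  ext1 η
  have hvel : linearizedVelocity hB 0 η (Γ 0) (fderiv ℝ Γ 0 η) = constCLM I E (B x₀ η) := by
    ext s
    simp [linearizedVelocity, hΓ₀]
  rw [fderiv_apply_one hΓ, fderiv_picard_fixedPoint hB hΓ hfix, hvel, map_zero, zero_add,
    pathPrimitive_constCLM]

theorem range_fderiv_apply_one_le [CompleteSpace E] [CompleteSpace F] (hB : ContDiff ℝ ∞ B)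
    (hΓ : DifferentiableAt ℝ Γ ξ) (hfix : ∀ᶠ ξ in 𝓝 ξ, Γ ξ = picard B x₀ ξ (Γ ξ))
    (hJ : ∀ s, D.JacobiAt B (Γ ξ s)) (hA : ∀ s, ‖(fderiv ℝ B (Γ ξ s)).flip ξ‖ ≤ 1 / 2) :
    (fderiv ℝ (fun ξ => Γ ξ 1) ξ).range ≤ (B (Γ ξ 1)).range := by
  rintro _ ⟨η, rfl⟩
  have hlin := fderiv_picard_fixedPoint hB hΓ hfix η
  obtain ⟨α, hα⟩ := exists_eq_apply_of_linearized hB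
    (fun s hs => hasDerivWithinAt_picard_fixedPoint hfix.self_of_nhds hs)
    (fun _ _ => hJ _) (fun _ _ => hA _) (ψ := IccExtend (zero_le_one' ℝ) (fderiv ℝ Γ ξ η))
    (by rw [IccExtend_left, hlin]; simp [pathPrimitive_zero])
    (fun s hs => hasDerivWithinAt_IccExtend_of_eq_primitive hlin hs)
  rw [IccExtend_right, IccExtend_right] at hα
  exact ⟨α, hα.symm.trans (fderiv_apply_one hΓ η).symm⟩

theorem finrank_range_apply_one_le [FiniteDimensional ℝ E] (hB : ContDiff ℝ ∞ B) {γ : C(I, E)}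
    (hγ : γ = picard B x₀ ξ γ) (hJ : ∀ s, D.JacobiAt B (γ s))
    (hA : ∀ s, ‖(fderiv ℝ B (γ s)).flip ξ‖ ≤ 1 / 2) :
    Module.finrank ℝ (B (γ 1)).range ≤ Module.finrank ℝ (B x₀).range := by
  have : CompleteSpace E := FiniteDimensional.complete ℝ E
  obtain ⟨Q, hQ⟩ := exists_conj_of_hamiltonian_curve hB
    (fun s hs => hasDerivWithinAt_picard_fixedPoint hγ hs) (fun _ _ => hJ _) (fun _ _ => hA _)
  have hγ₀ : γ ⟨0, by simp⟩ = x₀ := by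
    rw [hγ]
    exact picard_apply_zero B x₀ ξ γ
  rw [IccExtend_right, IccExtend_left, hγ₀] at hQ
  have hle : (B (γ 1)).range ≤ (B x₀).range.map Q.toLinearMap := by
    rintro _ ⟨ζ, rfl⟩
    exact ⟨_, ⟨D.toCLM Q ζ, rfl⟩, (DFunLike.congr_fun hQ ζ).symm⟩
  exact (Submodule.finrank_mono hle).trans (Submodule.finrank_map_le _ _)

omit [NormedSpace ℝ F] in
theorem eventually_forall_path_mem (hΓ₀ : Γ 0 = constCLM I E x₀) (hΓ : ContinuousAt Γ 0)
    {V : Set E} (hV : V ∈ 𝓝 x₀) : ∀ᶠ ξ in 𝓝 0, ∀ s, Γ ξ s ∈ V := by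
  obtain ⟨δ, hδ, hball⟩ := Metric.mem_nhds_iff.1 hV
  filter_upwards [hΓ.eventually (Metric.ball_mem_nhds _ hδ)] with ξ hξ s
  rw [hΓ₀] at hξ
  exact hball ((ContinuousMap.dist_apply_le_dist (g := constCLM I E x₀) s).trans_lt hξ)

theorem eventually_norm_flip_fderiv_le (hB : ContDiff ℝ ∞ B) (hΓ₀ : Γ 0 = constCLM I E x₀)
    (hΓ : ContinuousAt Γ 0) : ∀ᶠ ξ in 𝓝 0, ∀ s, ‖(fderiv ℝ B (Γ ξ s)).flip ξ‖ ≤ 1 / 2 := by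
  have hbdd : {z | ‖fderiv ℝ B z‖ < ‖fderiv ℝ B x₀‖ + 1} ∈ 𝓝 x₀ :=
    (hB.continuous_fderiv (by simp)).norm.continuousAt.eventually (gt_mem_nhds (lt_add_one _))
  have hsmall : ∀ᶠ ξ in 𝓝 (0 : F), (‖fderiv ℝ B x₀‖ + 1) * ‖ξ‖ < 1 / 2 :=
    (continuous_const.mul continuous_norm).continuousAt.eventually (gt_mem_nhds (by simp))
  filter_upwards [eventually_forall_path_mem hΓ₀ hΓ hbdd, hsmall] with ξ hξ hξs s
  calc ‖(fderiv ℝ B (Γ ξ s)).flip ξ‖ ≤ ‖(fderiv ℝ B (Γ ξ s)).flip‖ * ‖ξ‖ :=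
        ContinuousLinearMap.le_opNorm _ ξ
    _ ≤ (‖fderiv ℝ B x₀‖ + 1) * ‖ξ‖ := by
        rw [ContinuousLinearMap.opNorm_flip]
        gcongr
        exact (hξ s).le
    _ ≤ 1 / 2 := hξs.le

theorem exists_timeOne_map [FiniteDimensional ℝ E] [FiniteDimensional ℝ F] (hB : ContDiff ℝ ∞ B)
    {U : Set E} (hU : U ∈ 𝓝 x₀) (hJ : ∀ z ∈ U, D.JacobiAt B z) :
    ∃ φ : F → E, φ 0 = x₀ ∧ fderiv ℝ φ 0 = B x₀ ∧
      ∀ᶠ ξ in 𝓝 (0 : F), ContDiffAt ℝ ∞ φ ξ ∧ φ ξ ∈ U ∧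
        (fderiv ℝ φ ξ).range ≤ (B (φ ξ)).range ∧
        Module.finrank ℝ (B (φ ξ)).range ≤ Module.finrank ℝ (B x₀).range := by
  have : CompleteSpace E := FiniteDimensional.complete ℝ E
  have : CompleteSpace F := FiniteDimensional.complete ℝ F
  obtain ⟨Γ, hΓ₀, hΓ⟩ := exists_contDiffAt_picard_fixedPoint hB x₀
  have hdiff : ∀ ξ, ContDiffAt ℝ ∞ Γ ξ → DifferentiableAt ℝ Γ ξ := fun _ h =>
    h.differentiableAt (by simp)
  let ev : C(I, E) →L[ℝ] E := ContinuousMap.evalCLM ℝ (1 : I)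
  have hcont : ContinuousAt Γ 0 := hΓ.self_of_nhds.1.continuousAt
  refine ⟨fun ξ => Γ ξ 1, congrArg (fun u : C(I, E) => u 1) hΓ₀,
    fderiv_apply_one_zero hB hΓ₀ (hdiff 0 hΓ.self_of_nhds.1) (hΓ.mono fun _ h => h.2), ?_⟩
  filter_upwards [hΓ.eventually_nhds, eventually_forall_path_mem hΓ₀ hcont hU,
    eventually_norm_flip_fderiv_le hB hΓ₀ hcont] with ξ hξ hmem hA
  obtain ⟨hsmooth, hfix⟩ := hξ.self_of_nhds
  exact ⟨ev.contDiff.contDiffAt.comp ξ hsmooth, hmem 1,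
    range_fderiv_apply_one_le hB (hdiff ξ hsmooth) (hξ.mono fun _ h => h.2)
      (fun s => hJ _ (hmem s)) hA,
    finrank_range_apply_one_le hB hfix (fun s => hJ _ (hmem s)) hA⟩

end TimeOneMap

section Immersions

open Set Filter Topology

variable {E G : Type*} [NormedAddCommGroup E] [NormedSpace ℝ E] [NormedAddCommGroup G]

theorem exists_mem_nhds_injOn_of_injective_fderiv [FiniteDimensional ℝ E] [NormedSpace ℝ G]
    [FiniteDimensional ℝ G] {φ : G → E} {w₀ : G} (hφ : ContDiffAt ℝ ∞ φ w₀)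
    (hinj : Function.Injective (fderiv ℝ φ w₀)) : ∃ s ∈ 𝓝 w₀, InjOn φ s := by
  have : CompleteSpace G := FiniteDimensional.complete ℝ G
  obtain ⟨S₀, hS₀⟩ := (fderiv ℝ φ w₀).toLinearMap.exists_leftInverse_of_injective
    (LinearMap.ker_eq_bot.2 hinj)
  let S : E →L[ℝ] G := LinearMap.toContinuousLinearMap S₀
  have hS : S ∘L fderiv ℝ φ w₀ = (ContinuousLinearEquiv.refl ℝ G : G →L[ℝ] G) := by
    ext w
    exact LinearMap.congr_fun hS₀ w
  have hstrict : HasStrictFDerivAt (fun w => S (φ w))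
      (ContinuousLinearEquiv.refl ℝ G : G →L[ℝ] G) w₀ := by
    rw [← hS]
    exact S.hasStrictFDerivAt.comp w₀ (hφ.hasStrictFDerivAt (by simp))
  let Φ := hstrict.toOpenPartialHomeomorph (fun w => S (φ w))
  exact ⟨Φ.source, Φ.open_source.mem_nhds hstrict.mem_toOpenPartialHomeomorph_source,
    fun a ha b hb hab => Φ.injOn ha hb (congrArg S hab)⟩

variable [InnerProductSpace ℝ G]

theorem bijective_fderiv_univBall (c : G) {r : ℝ} (hr : 0 < r) (w : G) :
    Function.Bijective (fderiv ℝ (OpenPartialHomeomorph.univBall c r) w) := by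
  have hb : (OpenPartialHomeomorph.univBall c r).MDifferentiable 𝓘(ℝ, G) 𝓘(ℝ, G) := by
    refine ⟨((OpenPartialHomeomorph.contDiff_univBall (n := 1)).differentiable
      (by simp)).mdifferentiable.mdifferentiableOn, ?_⟩
    rw [OpenPartialHomeomorph.univBall_target c hr]
    exact (OpenPartialHomeomorph.contDiffOn_univBall_symm.differentiableOn
      one_ne_zero).mdifferentiableOn
  rw [← mfderiv_eq_fderiv]
  exact hb.mfderiv_bijective (by simp)

theorem exists_contDiff_injective_forall_mem {s : Set G} (hs : s ∈ 𝓝 (0 : G)) :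
    ∃ b : G → G, ContDiff ℝ ∞ b ∧ Function.Injective b ∧ b 0 = 0 ∧
      ∀ w, b w ∈ s ∧ Function.Bijective (fderiv ℝ b w) := by
  obtain ⟨ρ, hρ, hball⟩ := Metric.mem_nhds_iff.1 hs
  let b := OpenPartialHomeomorph.univBall (0 : G) ρ
  refine ⟨b, OpenPartialHomeomorph.contDiff_univBall, fun v w hvw => b.injOn (by simp [b])
    (by simp [b]) hvw, by simp [b], fun w => ⟨hball ?_, bijective_fderiv_univBall 0 hρ w⟩⟩
  rw [← OpenPartialHomeomorph.univBall_target 0 hρ]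
  exact b.map_source (by simp [b])

end Immersions

section IntegralManifolds

open Set Filter Topology

universe u

variable {E F : Type u} [NormedAddCommGroup E] [NormedSpace ℝ E] [FiniteDimensional ℝ E]
  [NormedAddCommGroup F] [NormedSpace ℝ F]

omit [FiniteDimensional ℝ E] in
theorem exists_injective_comp_finrank_range [FiniteDimensional ℝ F] (T : F →L[ℝ] E) :
    ∃ l : EuclideanSpace ℝ (Fin (Module.finrank ℝ T.range)) →L[ℝ] F,
      Function.Injective (T ∘L l) := by
  obtain ⟨r, hr⟩ := T.toLinearMap.rangeRestrict.exists_rightInverse_of_surjective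
    (LinearMap.range_rangeRestrict _)
  let e : EuclideanSpace ℝ (Fin (Module.finrank ℝ T.range)) ≃ₗ[ℝ] T.range :=
    LinearEquiv.ofFinrankEq _ _ (by simp)
  refine ⟨LinearMap.toContinuousLinearMap (r ∘ₗ e.toLinearMap), fun a b hab => ?_⟩
  have hTr : ∀ w, T (r (e w)) = e w := fun w => congrArg Subtype.val (LinearMap.congr_fun hr (e w))
  exact e.injective (Subtype.ext ((hTr a).symm.trans (hab.trans (hTr b))))

variable [FiniteDimensional ℝ F] {D : Transposition E F} {B : C(E, F →L[ℝ] E)}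

/-- The time-one map is restricted to a complement of the kernel of `B x₀`, where its differential
is injective; the rank of `B` not increasing, this differential fills the range of `B`. -/
theorem exists_integral_immersion_germ (hB : ContDiff ℝ ∞ B) {x₀ : E} {U : Set E} (hU : U ∈ 𝓝 x₀)
    (hJ : ∀ z ∈ U, D.JacobiAt B z) :
    ∃ (k : ℕ) (φ : EuclideanSpace ℝ (Fin k) → E), φ 0 = x₀ ∧
      (∃ s ∈ 𝓝 0, InjOn φ s) ∧ ∀ᶠ w in 𝓝 0, ContDiffAt ℝ ∞ φ w ∧ φ w ∈ U ∧
        Function.Injective (fderiv ℝ φ w) ∧ (fderiv ℝ φ w).range = (B (φ w)).range := by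
  obtain ⟨φ, hφ₀, hφ', hφ⟩ := exists_timeOne_map hB hU hJ
  obtain ⟨l, hl⟩ := exists_injective_comp_finrank_range (B x₀)
  have hfderiv : ∀ w, ContDiffAt ℝ ∞ φ (l w) → fderiv ℝ (φ ∘ l) w = fderiv ℝ φ (l w) ∘L l :=
    fun w hw => ((hw.differentiableAt (by simp)).hasFDerivAt.comp w l.hasFDerivAt).fderiv
  have hφl : ∀ᶠ w in 𝓝 0, ContDiffAt ℝ ∞ φ (l w) ∧ φ (l w) ∈ U ∧ _ :=
    (l.continuous.tendsto' 0 0 (map_zero l)).eventually hφ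
  have hsmooth : ∀ w, ContDiffAt ℝ ∞ φ (l w) → ContDiffAt ℝ ∞ (φ ∘ l) w := fun w hw =>
    hw.comp w l.contDiff.contDiffAt
  have hsmooth₀ := hsmooth 0 hφl.self_of_nhds.1
  have hinj₀ : Function.Injective (fderiv ℝ (φ ∘ l) 0) := by
    rwa [hfderiv 0 hφl.self_of_nhds.1, map_zero, hφ']
  have hinj : ∀ᶠ w in 𝓝 0, Function.Injective (fderiv ℝ (φ ∘ l) w) :=
    (hsmooth₀.continuousAt_fderiv (by simp)).eventually
      (ContinuousLinearMap.isOpen_injective.mem_nhds hinj₀)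
  refine ⟨_, φ ∘ l, by simp [hφ₀], exists_mem_nhds_injOn_of_injective_fderiv hsmooth₀ hinj₀, ?_⟩
  filter_upwards [hφl, hinj] with w ⟨hw, hwU, hrange, hrank⟩ hwinj
  refine ⟨hsmooth w hw, hwU, hwinj, Submodule.eq_of_le_of_finrank_le ?_ ?_⟩
  · rw [hfderiv w hw]
    exact (LinearMap.range_comp_le_range _ _).trans hrange
  · refine hrank.trans_eq ?_
    rw [LinearMap.finrank_range_of_inj hwinj, finrank_euclideanSpace_fin]

theorem exists_integral_immersion (hB : ContDiff ℝ ∞ B) {x₀ : E} {U : Set E} (hU : U ∈ 𝓝 x₀)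
    (hJ : ∀ z ∈ U, D.JacobiAt B z) :
    ∃ (k : ℕ) (φ : EuclideanSpace ℝ (Fin k) → E), ContDiff ℝ ∞ φ ∧ Function.Injective φ ∧
      φ 0 = x₀ ∧ ∀ w, φ w ∈ U ∧ Function.Injective (fderiv ℝ φ w) ∧
        (fderiv ℝ φ w).range = (B (φ w)).range := by
  obtain ⟨k, φ, hφ₀, ⟨s, hs, hinj⟩, hφ⟩ := exists_integral_immersion_germ hB hU hJ
  obtain ⟨b, hb, hb_inj, hb₀, hb_mem⟩ := exists_contDiff_injective_forall_mem (inter_mem hs hφ)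
  have hfderiv : ∀ w, fderiv ℝ (φ ∘ b) w = fderiv ℝ φ (b w) ∘L fderiv ℝ b w := fun w =>
    (((hb_mem w).1.2.1.differentiableAt (by simp)).hasFDerivAt.comp w
      (hb.differentiable (by simp) w).hasFDerivAt).fderiv
  refine ⟨k, φ ∘ b, contDiff_iff_contDiffAt.2 fun w => (hb_mem w).1.2.1.comp w hb.contDiffAt,
    fun v w hvw => hb_inj (hinj (hb_mem v).1.1 (hb_mem w).1.1 hvw), by simp [hb₀, hφ₀],
    fun w => ?_⟩
  obtain ⟨⟨-, -, hU, hφ_inj, hφ_range⟩, hb_bij⟩ := hb_mem w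
  rw [hfderiv]
  exact ⟨hU, hφ_inj.comp hb_bij.1, (LinearMap.range_comp_of_range_eq_top _
    (LinearMap.range_eq_top.2 hb_bij.2)).trans hφ_range⟩

end IntegralManifolds

section Charts

open Set Filter Topology

variable {E : Type*} [NormedAddCommGroup E] [NormedSpace ℝ E]
  {M : Type*} [TopologicalSpace M] [ChartedSpace E M] [IsManifold 𝓘(ℝ, E) ∞ M] {x₀ : M}

theorem bijective_mvfderiv_extChartAt {x : M} (hx : x ∈ (extChartAt 𝓘(ℝ, E) x₀).source) :
    Function.Bijective (mvfderiv 𝓘(ℝ, E) (extChartAt 𝓘(ℝ, E) x₀) x) :=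
  (isInvertible_mfderiv_extChartAt hx).bijective

theorem exists_comp_mvfderiv_extChartAt {x : M} (hx : x ∈ (extChartAt 𝓘(ℝ, E) x₀).source)
    (θ : TangentSpace 𝓘(ℝ, E) x →L[ℝ] ℝ) :
    ∃ ξ : E →L[ℝ] ℝ, ξ.comp (mvfderiv 𝓘(ℝ, E) (extChartAt 𝓘(ℝ, E) x₀) x) = θ := by
  obtain ⟨e, he⟩ := isInvertible_mfderiv_extChartAt hx
  refine ⟨θ.comp e.symm.toContinuousLinearMap, ?_⟩
  ext v
  exact congrArg θ ((congrArg e.symm (DFunLike.congr_fun he v).symm).trans (e.symm_apply_apply v))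

theorem mvfderiv_comp_extChartAt {G : Type*} [NormedAddCommGroup G] [NormedSpace ℝ G] {g : E → G}
    {x : M} (hx : x ∈ (extChartAt 𝓘(ℝ, E) x₀).source)
    (hg : DifferentiableAt ℝ g (extChartAt 𝓘(ℝ, E) x₀ x)) :
    mvfderiv 𝓘(ℝ, E) (g ∘ extChartAt 𝓘(ℝ, E) x₀) x =
      (fderiv ℝ g (extChartAt 𝓘(ℝ, E) x₀ x)).comp
        (mvfderiv 𝓘(ℝ, E) (extChartAt 𝓘(ℝ, E) x₀) x) := by
  have hcomp := mfderiv_comp x hg.mdifferentiableAt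
    (mdifferentiableAt_extChartAt (I := 𝓘(ℝ, E)) (by simpa using hx))
  rwa [mfderiv_eq_fderiv] at hcomp

variable {F : Type*} [NormedAddCommGroup F] [NormedSpace ℝ F] {φ : F → E}

theorem contMDiff_extChartAt_symm_comp (hφ : ContDiff ℝ ∞ φ)
    (htarget : ∀ w, φ w ∈ (extChartAt 𝓘(ℝ, E) x₀).target) :
    ContMDiff 𝓘(ℝ, F) 𝓘(ℝ, E) ∞ ((extChartAt 𝓘(ℝ, E) x₀).symm ∘ φ) :=
  fun w => ((contMDiffOn_extChartAt_symm x₀).contMDiffAt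
    ((isOpen_extChartAt_target x₀).mem_nhds (htarget w))).comp w hφ.contMDiff.contMDiffAt

theorem mvfderiv_extChartAt_comp_mfderiv (hφ : ContDiff ℝ ∞ φ)
    (htarget : ∀ w, φ w ∈ (extChartAt 𝓘(ℝ, E) x₀).target) (w : F) :
    (mvfderiv 𝓘(ℝ, E) (extChartAt 𝓘(ℝ, E) x₀) ((extChartAt 𝓘(ℝ, E) x₀).symm (φ w))).comp
      (mfderiv 𝓘(ℝ, F) 𝓘(ℝ, E) ((extChartAt 𝓘(ℝ, E) x₀).symm ∘ φ) w) = fderiv ℝ φ w := by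
  set c := extChartAt 𝓘(ℝ, E) x₀
  have hcomp := mfderiv_comp w
    (mdifferentiableAt_extChartAt (I := 𝓘(ℝ, E))
      (by simpa only [c, extChartAt_source, Function.comp_apply] using c.map_target (htarget w)))
    ((contMDiff_extChartAt_symm_comp hφ htarget).mdifferentiable (by simp) w)
  have hsymm : c ∘ c.symm ∘ φ = φ := funext fun w => c.right_inv (htarget w)
  rw [hsymm, mfderiv_eq_fderiv] at hcomp
  exact hcomp.symm

theorem isIntegralSubmanifold_extChartAt_symm_comp
    {D : ∀ x : M, Submodule ℝ (TangentSpace 𝓘(ℝ, E) x)} (hφ : ContDiff ℝ ∞ φ)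
    (htarget : ∀ w, φ w ∈ (extChartAt 𝓘(ℝ, E) x₀).target) (hinj : Function.Injective φ)
    (himm : ∀ w, Function.Injective (fderiv ℝ φ w))
    (hrange : ∀ w, (fderiv ℝ φ w).range = (D ((extChartAt 𝓘(ℝ, E) x₀).symm (φ w))).map
      (mvfderiv 𝓘(ℝ, E) (extChartAt 𝓘(ℝ, E) x₀)
        ((extChartAt 𝓘(ℝ, E) x₀).symm (φ w))).toLinearMap) :
    IsIntegralSubmanifold (F := F) D ((extChartAt 𝓘(ℝ, E) x₀).symm ∘ φ) where
  contMDiff := contMDiff_extChartAt_symm_comp hφ htarget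
  injective w w' h := hinj ((extChartAt 𝓘(ℝ, E) x₀).symm.injOn (htarget w) (htarget w') h)
  immersion w u u' h := by
    refine himm w ?_
    rw [← mvfderiv_extChartAt_comp_mfderiv hφ htarget w]
    exact congrArg (mvfderiv 𝓘(ℝ, E) (extChartAt 𝓘(ℝ, E) x₀) _) h
  range_mfderiv w := by
    refine Submodule.map_injective_of_injective (bijective_mvfderiv_extChartAt
      ((extChartAt 𝓘(ℝ, E) x₀).map_target (htarget w))).injective ?_
    refine (LinearMap.range_comp _ _).symm.trans (Eq.trans ?_ (hrange w))
    rw [← mvfderiv_extChartAt_comp_mfderiv hφ htarget w]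
    rfl

end Charts

section CoordinateFunctions

open Set Filter Topology

variable {E : Type*} [NormedAddCommGroup E] [NormedSpace ℝ E] [FiniteDimensional ℝ E]
  {M : Type*} [TopologicalSpace M] [ChartedSpace E M]
  {x₀ : M} (χ : SmoothBumpFunction 𝓘(ℝ, E) x₀)

/-- The region of the chart at `x₀` near whose points the cut-off `χ` is constant. -/
def coordDomain : Set E :=
  {z ∈ (extChartAt 𝓘(ℝ, E) x₀).target | χ =ᶠ[𝓝 ((extChartAt 𝓘(ℝ, E) x₀).symm z)] 1}

theorem isOpen_coordDomain : IsOpen (coordDomain χ) :=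
  (continuousOn_extChartAt_symm x₀).isOpen_inter_preimage (isOpen_extChartAt_target x₀)
    isOpen_setOfPred_eventually_nhds

theorem extChartAt_self_mem_coordDomain : extChartAt 𝓘(ℝ, E) x₀ x₀ ∈ coordDomain χ := by
  refine ⟨mem_extChartAt_target x₀, ?_⟩
  rw [extChartAt_to_inv]
  exact χ.eventuallyEq_one

theorem eventually_extChartAt_mem_coordDomain {z : E} (hz : z ∈ coordDomain χ) :
    ∀ᶠ y in 𝓝 ((extChartAt 𝓘(ℝ, E) x₀).symm z), y ∈ (extChartAt 𝓘(ℝ, E) x₀).source ∧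
      extChartAt 𝓘(ℝ, E) x₀ y ∈ coordDomain χ := by
  have hx := (extChartAt 𝓘(ℝ, E) x₀).map_target hz.1
  refine Filter.Eventually.and ((isOpen_extChartAt_source x₀).mem_nhds hx) ?_
  refine (continuousAt_extChartAt' hx).eventually ?_
  rw [(extChartAt 𝓘(ℝ, E) x₀).right_inv hz.1]
  exact (isOpen_coordDomain χ).mem_nhds hz

variable [IsManifold 𝓘(ℝ, E) ∞ M] [T2Space M]

/-- The linear form `ξ` in the chart at `x₀`, cut off by `χ` to a smooth function on `M`. -/
noncomputable def coordFun (ξ : E →L[ℝ] ℝ) : C^∞⟮𝓘(ℝ, E), M; ℝ⟯ :=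
  ⟨fun x => χ x • ξ (extChartAt 𝓘(ℝ, E) x₀ x),
    χ.contMDiff_smul (ξ.contMDiff.comp_contMDiffOn contMDiffOn_extChartAt)⟩

theorem mvfderiv_coordFun {z : E} (hz : z ∈ coordDomain χ) (ξ : E →L[ℝ] ℝ) :
    mvfderiv 𝓘(ℝ, E) (coordFun χ ξ) ((extChartAt 𝓘(ℝ, E) x₀).symm z) =
      ξ.comp (mvfderiv 𝓘(ℝ, E) (extChartAt 𝓘(ℝ, E) x₀) ((extChartAt 𝓘(ℝ, E) x₀).symm z)) := by
  have hlocal : coordFun χ ξ =ᶠ[𝓝 ((extChartAt 𝓘(ℝ, E) x₀).symm z)]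
      ξ ∘ extChartAt 𝓘(ℝ, E) x₀ := by
    filter_upwards [hz.2] with y hy
    change χ y • ξ _ = _
    rw [hy, Pi.one_apply, one_smul, Function.comp_apply]
  have hcomp := mvfderiv_comp_extChartAt ((extChartAt 𝓘(ℝ, E) x₀).map_target hz.1)
    ξ.differentiableAt
  rw [ξ.fderiv] at hcomp
  exact hlocal.mfderiv_eq.trans hcomp

theorem exists_mvfderiv_eq (x : M) (θ : TangentSpace 𝓘(ℝ, E) x →L[ℝ] ℝ) :
    ∃ f : C^∞⟮𝓘(ℝ, E), M; ℝ⟯, mvfderiv 𝓘(ℝ, E) f x = θ := by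
  let χ : SmoothBumpFunction 𝓘(ℝ, E) x := Classical.arbitrary _
  obtain ⟨ξ, hξ⟩ := exists_comp_mvfderiv_extChartAt (mem_extChartAt_source x) θ
  have hcoord := mvfderiv_coordFun χ (extChartAt_self_mem_coordDomain χ) ξ
  rw [extChartAt_to_inv, hξ] at hcoord
  exact ⟨coordFun χ ξ, hcoord⟩

end CoordinateFunctions

section PoissonTensors

open Set Filter Topology

variable {E : Type*} [NormedAddCommGroup E] [NormedSpace ℝ E]
  {M : Type*} [TopologicalSpace M] [ChartedSpace E M]

/-- `Θ`, a family of maps `T*M → TM`, is the Poisson tensor of the bracket `P`: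
`P f h = df (Θ dh)`. -/
def IsPoissonTensor (Θ : ∀ x : M, (TangentSpace 𝓘(ℝ, E) x →L[ℝ] ℝ) →ₗ[ℝ] TangentSpace 𝓘(ℝ, E) x)
    (P : C^∞⟮𝓘(ℝ, E), M; ℝ⟯ → C^∞⟮𝓘(ℝ, E), M; ℝ⟯ → M → ℝ) : Prop :=
  ∀ f h x, P f h x = mvfderiv 𝓘(ℝ, E) f x (Θ x (mvfderiv 𝓘(ℝ, E) h x))

variable [FiniteDimensional ℝ E]
  (Θ : ∀ x : M, (TangentSpace 𝓘(ℝ, E) x →L[ℝ] ℝ) →ₗ[ℝ] TangentSpace 𝓘(ℝ, E) x) (x₀ : M)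

/-- The expression in the chart at `x₀` of a family `Θ` of maps `T*M → TM`. -/
noncomputable def chartTensor (z : E) : (E →L[ℝ] ℝ) →L[ℝ] E :=
  LinearMap.toContinuousLinearMap
    ((mvfderiv 𝓘(ℝ, E) (extChartAt 𝓘(ℝ, E) x₀)
        ((extChartAt 𝓘(ℝ, E) x₀).symm z)).toLinearMap ∘ₗ
      Θ ((extChartAt 𝓘(ℝ, E) x₀).symm z) ∘ₗ
      (ContinuousLinearMap.precomp ℝ (mvfderiv 𝓘(ℝ, E) (extChartAt 𝓘(ℝ, E) x₀)
        ((extChartAt 𝓘(ℝ, E) x₀).symm z))).toLinearMap)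

theorem chartTensor_apply (z : E) (ξ : E →L[ℝ] ℝ) :
    chartTensor Θ x₀ z ξ =
      mvfderiv 𝓘(ℝ, E) (extChartAt 𝓘(ℝ, E) x₀) ((extChartAt 𝓘(ℝ, E) x₀).symm z)
        (Θ ((extChartAt 𝓘(ℝ, E) x₀).symm z) (ξ.comp (mvfderiv 𝓘(ℝ, E) (extChartAt 𝓘(ℝ, E) x₀)
          ((extChartAt 𝓘(ℝ, E) x₀).symm z)))) := rfl

theorem range_chartTensor [IsManifold 𝓘(ℝ, E) ∞ M] {z : E}
    (hz : z ∈ (extChartAt 𝓘(ℝ, E) x₀).target) :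
    (chartTensor Θ x₀ z).range = (LinearMap.range (Θ ((extChartAt 𝓘(ℝ, E) x₀).symm z))).map
      (mvfderiv 𝓘(ℝ, E) (extChartAt 𝓘(ℝ, E) x₀)
        ((extChartAt 𝓘(ℝ, E) x₀).symm z)).toLinearMap := by
  have hsurj := exists_comp_mvfderiv_extChartAt ((extChartAt 𝓘(ℝ, E) x₀).map_target hz)
  refine (LinearMap.range_comp _ _).trans (congrArg _ ?_)
  exact LinearMap.range_comp_of_range_eq_top _ (LinearMap.range_eq_top.2 hsurj)

end PoissonTensors

section DualTransposition

variable (E : Type*) [NormedAddCommGroup E] [NormedSpace ℝ E]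

/-- The transposition of endomorphisms of `E`, acting on the dual space. -/
noncomputable def dualTransposition : Transposition E (E →L[ℝ] ℝ) where
  toCLM := (ContinuousLinearMap.compL ℝ E E ℝ).flip
  norm_le T := ContinuousLinearMap.opNorm_le_bound _ (norm_nonneg _) fun ζ =>
    (ζ.opNorm_comp_le T).trans_eq (mul_comm _ _)
  map_id := by ext; rfl
  map_comp S T := by ext; rfl

variable {E}

theorem dualTransposition_apply (T : E →L[ℝ] E) (ζ : E →L[ℝ] ℝ) :
    (dualTransposition E).toCLM T ζ = ζ.comp T := rfl

theorem Transposition.JacobiAt.congr_of_eventuallyEq {F : Type*} [NormedAddCommGroup F]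
    [NormedSpace ℝ F] {D : Transposition E F} {B B' : E → F →L[ℝ] E} {z : E}
    (hB : D.JacobiAt B z) (h : B' =ᶠ[nhds z] B) : D.JacobiAt B' z := fun ξ ζ => by
  rw [h.fderiv_eq, h.eq_of_nhds]
  exact hB ξ ζ

theorem fderiv_apply_clm_apply {F G : Type*} [NormedAddCommGroup F] [NormedSpace ℝ F]
    [NormedAddCommGroup G] [NormedSpace ℝ G] {B : E → F →L[ℝ] G} {z : E}
    (hB : DifferentiableAt ℝ B z) (η : G →L[ℝ] ℝ) (ξ : F) (v : E) :
    fderiv ℝ (fun z => η (B z ξ)) z v = η (fderiv ℝ B z v ξ) := by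
  have h : HasFDerivAt (fun z => η (B z ξ)) _ z :=
    η.hasFDerivAt.comp z (hB.hasFDerivAt.clm_apply (hasFDerivAt_const ξ z))
  rw [h.fderiv]
  simp

theorem contDiffOn_of_forall_dual [FiniteDimensional ℝ E] {G : Type*} [NormedAddCommGroup G]
    [NormedSpace ℝ G] {n : ℕ∞ω} {f : G → E} {s : Set G}
    (h : ∀ η : E →L[ℝ] ℝ, ContDiffOn ℝ n (fun z => η (f z)) s) : ContDiffOn ℝ n f s :=
  (toEuclidean (E := E)).comp_contDiffOn_iff.1 <| contDiffOn_euclidean.2 fun i =>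
    h ((EuclideanSpace.proj i).comp (toEuclidean (E := E)).toContinuousLinearMap)

end DualTransposition

namespace IsPoissonBracket

variable {E : Type*} [NormedAddCommGroup E] [NormedSpace ℝ E]
  {M : Type*} [TopologicalSpace M] [ChartedSpace E M]
  {P : C^∞⟮𝓘(ℝ, E), M; ℝ⟯ → C^∞⟮𝓘(ℝ, E), M; ℝ⟯ → M → ℝ}

/-- The Poisson bracket of two functions as a smooth function. -/
def bracket (hP : IsPoissonBracket P) (f h : C^∞⟮𝓘(ℝ, E), M; ℝ⟯) : C^∞⟮𝓘(ℝ, E), M; ℝ⟯ :=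
  ⟨P f h, hP.contMDiff f h⟩

theorem bracket_jacobi (hP : IsPoissonBracket P) (f h k : C^∞⟮𝓘(ℝ, E), M; ℝ⟯) (x : M) :
    P (hP.bracket h k) f x + P (hP.bracket k f) h x + P (hP.bracket f h) k x = 0 := by
  have hjacobi : P f (hP.bracket h k) x + P h (hP.bracket k f) x + P k (hP.bracket f h) x = 0 :=
    congrFun (hP.jacobi f h k) x
  rw [hP.skew f, hP.skew h, hP.skew k] at hjacobi
  simp only [Pi.neg_apply] at hjacobi
  linarith

end IsPoissonBracket

namespace IsPoissonTensor

open Set Filter Topology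

variable {E : Type*} [NormedAddCommGroup E] [NormedSpace ℝ E] [FiniteDimensional ℝ E]
  {M : Type*} [TopologicalSpace M] [ChartedSpace E M] [IsManifold 𝓘(ℝ, E) ∞ M] [T2Space M]
  {P : C^∞⟮𝓘(ℝ, E), M; ℝ⟯ → C^∞⟮𝓘(ℝ, E), M; ℝ⟯ → M → ℝ}
  {Θ : ∀ x : M, (TangentSpace 𝓘(ℝ, E) x →L[ℝ] ℝ) →ₗ[ℝ] TangentSpace 𝓘(ℝ, E) x}
  (hΘ : IsPoissonTensor Θ P) (hP : IsPoissonBracket P)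
  {x₀ : M} (χ : SmoothBumpFunction 𝓘(ℝ, E) x₀) {z : E} (hz : z ∈ coordDomain χ)

include hΘ hz in
theorem apply_chartTensor (ξ η : E →L[ℝ] ℝ) :
    η (chartTensor Θ x₀ z ξ) =
      P (coordFun χ η) (coordFun χ ξ) ((extChartAt 𝓘(ℝ, E) x₀).symm z) := by
  rw [hΘ, mvfderiv_coordFun χ hz, mvfderiv_coordFun χ hz]
  rfl

include hΘ hP in
theorem contDiffOn_chartTensor : ContDiffOn ℝ ∞ (chartTensor Θ x₀) (coordDomain χ) := by
  refine contDiffOn_clm_apply.2 fun ξ => contDiffOn_of_forall_dual fun η => ?_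
  have hbracket := ((hP.contMDiff (coordFun χ η) (coordFun χ ξ)).comp_contMDiffOn
    ((contMDiffOn_extChartAt_symm x₀).mono fun _ hz => hz.1)).contDiffOn (s := coordDomain χ)
  exact hbracket.congr fun z hz => hΘ.apply_chartTensor χ hz ξ η

include hΘ hP hz

theorem differentiableAt_chartTensor : DifferentiableAt ℝ (chartTensor Θ x₀) z :=
  ((hΘ.contDiffOn_chartTensor hP χ).contDiffAt
    ((isOpen_coordDomain χ).mem_nhds hz)).differentiableAt (by simp)

theorem apply_chartTensor_skew (ξ η : E →L[ℝ] ℝ) :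
    η (chartTensor Θ x₀ z ξ) = -ξ (chartTensor Θ x₀ z η) := by
  rw [hΘ.apply_chartTensor χ hz, hΘ.apply_chartTensor χ hz, hP.skew, Pi.neg_apply]

theorem apply_fderiv_chartTensor_skew (ξ η : E →L[ℝ] ℝ) (v : E) :
    η (fderiv ℝ (chartTensor Θ x₀) z v ξ) = -ξ (fderiv ℝ (chartTensor Θ x₀) z v η) := by
  have hB := hΘ.differentiableAt_chartTensor hP χ hz
  have hskew : (fun z => η (chartTensor Θ x₀ z ξ)) =ᶠ[𝓝 z] fun z => -ξ (chartTensor Θ x₀ z η) := by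
    filter_upwards [(isOpen_coordDomain χ).mem_nhds hz] with z hz
    exact hΘ.apply_chartTensor_skew hP χ hz ξ η
  rw [← fderiv_apply_clm_apply hB, ← fderiv_apply_clm_apply hB, hskew.fderiv_eq, fderiv_fun_neg]
  rfl

theorem bracket_bracket_coordFun (θ ζ ξ : E →L[ℝ] ℝ) :
    P (hP.bracket (coordFun χ θ) (coordFun χ ζ)) (coordFun χ ξ)
        ((extChartAt 𝓘(ℝ, E) x₀).symm z) =
      θ (fderiv ℝ (chartTensor Θ x₀) z (chartTensor Θ x₀ z ξ) ζ) := by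
  have hB := hΘ.differentiableAt_chartTensor hP χ hz
  have hright := (extChartAt 𝓘(ℝ, E) x₀).right_inv hz.1
  have hlocal : P (coordFun χ θ) (coordFun χ ζ) =ᶠ[𝓝 ((extChartAt 𝓘(ℝ, E) x₀).symm z)]
      (fun z => θ (chartTensor Θ x₀ z ζ)) ∘ extChartAt 𝓘(ℝ, E) x₀ := by
    filter_upwards [eventually_extChartAt_mem_coordDomain χ hz] with y hy
    rw [Function.comp_apply, hΘ.apply_chartTensor χ hy.2, (extChartAt 𝓘(ℝ, E) x₀).left_inv hy.1]
  have hdiff : DifferentiableAt ℝ (fun z => θ (chartTensor Θ x₀ z ζ))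
      (extChartAt 𝓘(ℝ, E) x₀ ((extChartAt 𝓘(ℝ, E) x₀).symm z)) := by
    rw [hright]
    exact θ.differentiableAt.comp z (hB.clm_apply (differentiableAt_const ζ))
  have hderiv := hlocal.mfderiv_eq.trans
    (mvfderiv_comp_extChartAt ((extChartAt 𝓘(ℝ, E) x₀).map_target hz.1) hdiff)
  rw [hΘ, ← fderiv_apply_clm_apply hB, chartTensor_apply, ← mvfderiv_coordFun χ hz]
  refine (DFunLike.congr_fun hderiv _).trans ?_
  rw [hright]
  rfl

theorem jacobiAt_chartTensor : (dualTransposition E).JacobiAt (chartTensor Θ x₀) z := by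
  intro ξ ζ
  refine (SeparatingDual.eq_iff_forall_dual_eq (R := ℝ)).2 fun θ => ?_
  have hjacobi := hP.bracket_jacobi (coordFun χ ξ) (coordFun χ θ) (coordFun χ ζ)
    ((extChartAt 𝓘(ℝ, E) x₀).symm z)
  simp only [hΘ.bracket_bracket_coordFun hP χ hz] at hjacobi
  have hDskew := hΘ.apply_fderiv_chartTensor_skew hP χ hz ξ θ (chartTensor Θ x₀ z ζ)
  have hskew := hΘ.apply_chartTensor_skew hP χ hz
    ((dualTransposition E).toCLM ((fderiv ℝ (chartTensor Θ x₀) z).flip ξ) ζ) θ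
  rw [dualTransposition_apply] at hskew ⊢
  rw [map_add, hskew, ContinuousLinearMap.comp_apply, ContinuousLinearMap.flip_apply]
  linarith

end IsPoissonTensor

section Integrability

open Set Filter Topology

universe u

theorem exists_contDiff_eventuallyEq {E G : Type*} [NormedAddCommGroup E] [NormedSpace ℝ E]
    [FiniteDimensional ℝ E] [NormedAddCommGroup G] [NormedSpace ℝ G] {f : E → G} {s : Set E}
    (hs : IsOpen s) {z : E} (hz : z ∈ s) (hf : ContDiffOn ℝ ∞ f s) :
    ∃ g : E → G, ContDiff ℝ ∞ g ∧ g =ᶠ[𝓝 z] f := by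
  obtain ⟨r, hr, hrs⟩ := Metric.nhds_basis_closedBall.mem_iff.1 (hs.mem_nhds hz)
  let χ : ContDiffBump z := ⟨r / 2, r, half_pos hr, half_lt_self hr⟩
  refine ⟨fun y => χ y • f y, contDiff_iff_contDiffAt.2 fun y => ?_, ?_⟩
  · by_cases hy : y ∈ s
    · exact χ.contDiff.contDiffAt.fun_smul (hf.contDiffAt (hs.mem_nhds hy))
    · have hsupp : y ∉ tsupport χ := by
        rw [χ.tsupport_eq]
        exact fun h => hy (hrs h)
      refine (contDiffAt_const (c := (0 : G))).congr_of_eventuallyEq ?_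
      filter_upwards [notMem_tsupport_iff_eventuallyEq.1 hsupp] with w hw
      simp [hw]
  · filter_upwards [χ.eventuallyEq_one] with y hy
    simp [hy]

variable {E : Type u} [NormedAddCommGroup E] [NormedSpace ℝ E] [FiniteDimensional ℝ E]
  {M : Type*} [TopologicalSpace M] [ChartedSpace E M] [IsManifold 𝓘(ℝ, E) ∞ M] [T2Space M]

theorem IsPoissonTensor.isIntegrableDistribution_range
    {P : C^∞⟮𝓘(ℝ, E), M; ℝ⟯ → C^∞⟮𝓘(ℝ, E), M; ℝ⟯ → M → ℝ}
    {Θ : ∀ x : M, (TangentSpace 𝓘(ℝ, E) x →L[ℝ] ℝ) →ₗ[ℝ] TangentSpace 𝓘(ℝ, E) x}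
    (hΘ : IsPoissonTensor Θ P) (hP : IsPoissonBracket P) :
    IsIntegrableDistribution fun x => LinearMap.range (Θ x) := by
  intro x₀
  let χ : SmoothBumpFunction 𝓘(ℝ, E) x₀ := Classical.arbitrary _
  have hx₀ := extChartAt_self_mem_coordDomain χ
  obtain ⟨B, hB, hBeq⟩ := exists_contDiff_eventuallyEq (isOpen_coordDomain χ) hx₀
    (hΘ.contDiffOn_chartTensor hP χ)
  have hU : {z | z ∈ coordDomain χ ∧ B =ᶠ[𝓝 z] chartTensor Θ x₀} ∈ 𝓝 (extChartAt 𝓘(ℝ, E) x₀ x₀) :=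
    inter_mem ((isOpen_coordDomain χ).mem_nhds hx₀) hBeq.eventually_nhds
  obtain ⟨k, φ, hφ, hinj, hφ₀, hφU⟩ := exists_integral_immersion (B := ⟨B, hB.continuous⟩) hB hU
    fun z hz => (hΘ.jacobiAt_chartTensor hP χ hz.1).congr_of_eventuallyEq hz.2
  have htarget : ∀ w, φ w ∈ (extChartAt 𝓘(ℝ, E) x₀).target := fun w => (hφU w).1.1.1
  refine ⟨k, EuclideanSpace ℝ (Fin k), inferInstance, inferInstance, inferInstance, inferInstance,
    inferInstance, inferInstance, (extChartAt 𝓘(ℝ, E) x₀).symm ∘ φ,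
    isIntegralSubmanifold_extChartAt_symm_comp hφ htarget hinj (fun w => (hφU w).2.1) fun w => ?_,
    0, ?_⟩
  · rw [← range_chartTensor Θ x₀ (htarget w), ← (hφU w).1.2.eq_of_nhds]
    exact (hφU w).2.2
  · rw [Function.comp_apply, hφ₀, extChartAt_to_inv]

variable {V : Type*} [NormedAddCommGroup V] [NormedSpace ℝ V] [FiniteDimensional ℝ V]
  {A : M → Type*} [TopologicalSpace (TotalSpace V A)]
  [∀ x, AddCommGroup (A x)] [∀ x, Module ℝ (A x)] [∀ x, TopologicalSpace (A x)]
  [∀ x, IsTopologicalAddGroup (A x)] [∀ x, ContinuousConstSMul ℝ (A x)]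
  [FiberBundle V A] [VectorBundle ℝ V A] [ContMDiffVectorBundle ∞ V A 𝓘(ℝ, E)]
  {𝓐 : LieAlgebroid E V A} (τ : CompatibleTriple 𝓐)

namespace CompatibleTriple

theorem isIntegrableDistribution_Λ : IsIntegrableDistribution τ.Λ := by
  have hΘ : IsPoissonTensor τ.Ω.poissonTensor τ.Ω.poissonBracket :=
    fun f h x => τ.Ω.poissonBracket_eq_poissonTensor f h x
  simpa only [τ.range_poissonTensor] using
    hΘ.isIntegrableDistribution_range τ.Ω.isPoissonBracket

theorem isSmoothDistribution_Λ : IsSmoothDistribution τ.Λ := by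
  intro x v hv
  rw [← τ.range_poissonTensor] at hv
  obtain ⟨θ, rfl⟩ := hv
  obtain ⟨f, rfl⟩ := exists_mvfderiv_eq x θ
  refine ⟨⟨fun y => 𝓐.anchor y (τ.Ω.hamiltonian f y), fun y =>
    𝓐.contMDiffAt_anchor_apply (τ.Ω.contMDiff_hamiltonian _ y)⟩,
    (τ.Ω.poissonTensor_mvfderiv f x).symm, fun y => ?_⟩
  rw [← τ.range_poissonTensor]
  exact ⟨_, τ.Ω.poissonTensor_mvfderiv f y⟩

end CompatibleTriple

end Integrability

section TwoForms

section Forms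

variable {E : Type*} [NormedAddCommGroup E] [NormedSpace ℝ E]
  {M : Type*} [TopologicalSpace M] [ChartedSpace E M]
  {A : M → Type*} [∀ x, AddCommGroup (A x)] [∀ x, Module ℝ (A x)] [∀ x, TopologicalSpace (A x)]
  {η : ∀ x, A x →L[ℝ] A x →L[ℝ] ℝ} {S S' T : ∀ x, A x} {x : M}

theorem mvfderiv_form_smul_left {f : M → ℝ} (hf : MDifferentiableAt 𝓘(ℝ, E) 𝓘(ℝ, ℝ) f x)
    (hST : MDifferentiableAt 𝓘(ℝ, E) 𝓘(ℝ, ℝ) (fun y => η y (S y) (T y)) x)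
    (v : TangentSpace 𝓘(ℝ, E) x) :
    mvfderiv 𝓘(ℝ, E) (fun y => η y ((f • S) y) (T y)) x v =
      f x * mvfderiv 𝓘(ℝ, E) (fun y => η y (S y) (T y)) x v +
        η x (S x) (T x) * mvfderiv 𝓘(ℝ, E) f x v := by
  have form_smul_eq : (fun y => η y ((f • S) y) (T y)) = f * fun y => η y (S y) (T y) := by
    ext y
    simp
  rw [form_smul_eq, mvfderiv_mul hf hST]
  simp

theorem mvfderiv_form_add_left
    (hST : MDifferentiableAt 𝓘(ℝ, E) 𝓘(ℝ, ℝ) (fun y => η y (S y) (T y)) x)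
    (hS'T : MDifferentiableAt 𝓘(ℝ, E) 𝓘(ℝ, ℝ) (fun y => η y (S' y) (T y)) x)
    (v : TangentSpace 𝓘(ℝ, E) x) :
    mvfderiv 𝓘(ℝ, E) (fun y => η y ((S + S') y) (T y)) x v =
      mvfderiv 𝓘(ℝ, E) (fun y => η y (S y) (T y)) x v +
        mvfderiv 𝓘(ℝ, E) (fun y => η y (S' y) (T y)) x v := by
  have form_add_eq : (fun y => η y ((S + S') y) (T y)) =
      (fun y => η y (S y) (T y)) + fun y => η y (S' y) (T y) := by
    ext y
    simp
  rw [form_add_eq, mvfderiv_add hST hS'T, add_apply]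

end Forms

variable {F : Type*} [NormedAddCommGroup F] [NormedSpace ℝ F]
  {O : Type*} [TopologicalSpace O] [ChartedSpace F O]
  {η : ∀ p : O, TangentSpace 𝓘(ℝ, F) p →L[ℝ] TangentSpace 𝓘(ℝ, F) p →L[ℝ] ℝ}

variable (η) in
/-- The exterior derivative of a 2-form, evaluated on vector fields that need not be smooth, so
that its tensoriality can be expressed by `TensorialAt`. -/
noncomputable def extDerivTwo (X Y Z : ∀ p : O, TangentSpace 𝓘(ℝ, F) p) (p : O) : ℝ :=
  mvfderiv 𝓘(ℝ, F) (fun q => η q (Y q) (Z q)) p (X p)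
    - mvfderiv 𝓘(ℝ, F) (fun q => η q (X q) (Z q)) p (Y p)
    + mvfderiv 𝓘(ℝ, F) (fun q => η q (X q) (Y q)) p (Z p)
    - η p (mlieBracket 𝓘(ℝ, F) X Y p) (Z p)
    + η p (mlieBracket 𝓘(ℝ, F) X Z p) (Y p)
    - η p (mlieBracket 𝓘(ℝ, F) Y Z p) (X p)

theorem extDerivTwo_swap_left (hη : ∀ p a, η p a a = 0)
    (X Y Z : ∀ p : O, TangentSpace 𝓘(ℝ, F) p) (p : O) :
    extDerivTwo η X Y Z p = -extDerivTwo η Y X Z p := by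
  rw [extDerivTwo, extDerivTwo, mvfderiv_form_swap hη X Y, mlieBracket_swap_apply (V := X),
    map_neg, neg_apply]
  ring

theorem extDerivTwo_swap_right (hη : ∀ p a, η p a a = 0)
    (X Y Z : ∀ p : O, TangentSpace 𝓘(ℝ, F) p) (p : O) :
    extDerivTwo η X Y Z p = -extDerivTwo η X Z Y p := by
  rw [extDerivTwo, extDerivTwo, mvfderiv_form_swap hη Y Z,
    mlieBracket_swap_apply (V := Y) (W := Z), map_neg, neg_apply]
  ring

variable [IsManifold 𝓘(ℝ, F) ∞ O]

theorem mdifferentiableAt_twoForm_apply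
    (hη : ContMDiff 𝓘(ℝ, F) (𝓘(ℝ, F).prod 𝓘(ℝ, F →L[ℝ] F →L[ℝ] ℝ)) ∞
      (fun p => TotalSpace.mk' (F →L[ℝ] F →L[ℝ] ℝ) p (η p)))
    {X Y : ∀ p : O, TangentSpace 𝓘(ℝ, F) p} {p : O}
    (hX : MDifferentiableAt 𝓘(ℝ, F) 𝓘(ℝ, F).tangent
      (fun q => (⟨q, X q⟩ : TangentBundle 𝓘(ℝ, F) O)) p)
    (hY : MDifferentiableAt 𝓘(ℝ, F) 𝓘(ℝ, F).tangent
      (fun q => (⟨q, Y q⟩ : TangentBundle 𝓘(ℝ, F) O)) p) :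
    MDifferentiableAt 𝓘(ℝ, F) 𝓘(ℝ, ℝ) (fun q => η q (X q) (Y q)) p := by
  have h := MDifferentiableAt.clm_bundle_apply₂ (F₁ := F) (F₂ := F) (F₃ := ℝ)
    (E₃ := Bundle.Trivial O ℝ) (hη.mdifferentiable (by simp) p) hX hY
  simp only [mdifferentiableAt_totalSpace] at h
  exact h.2

variable [FiniteDimensional ℝ F]

theorem tangentLieAlgebroid_d₂
    (S T U : Cₛ^∞⟮𝓘(ℝ, F); F, (TangentSpace 𝓘(ℝ, F) : O → Type _)⟯) (p : O) :
    (tangentLieAlgebroid F O).d₂ η S T U p = extDerivTwo η S T U p := rfl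

theorem tensorialAt_extDerivTwo
    (hη : ContMDiff 𝓘(ℝ, F) (𝓘(ℝ, F).prod 𝓘(ℝ, F →L[ℝ] F →L[ℝ] ℝ)) ∞
      (fun p => TotalSpace.mk' (F →L[ℝ] F →L[ℝ] ℝ) p (η p)))
    {Y Z : ∀ p : O, TangentSpace 𝓘(ℝ, F) p} {p : O}
    (hY : MDifferentiableAt 𝓘(ℝ, F) 𝓘(ℝ, F).tangent
      (fun q => (⟨q, Y q⟩ : TangentBundle 𝓘(ℝ, F) O)) p)
    (hZ : MDifferentiableAt 𝓘(ℝ, F) 𝓘(ℝ, F).tangent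
      (fun q => (⟨q, Z q⟩ : TangentBundle 𝓘(ℝ, F) O)) p) :
    TensorialAt 𝓘(ℝ, F) F (fun X => extDerivTwo η X Y Z p) p := by
  have : CompleteSpace F := FiniteDimensional.complete ℝ F
  constructor
  · intro f X hf hX
    rw [extDerivTwo, mvfderiv_form_smul_left hf (mdifferentiableAt_twoForm_apply hη hX hZ),
      mvfderiv_form_smul_left hf (mdifferentiableAt_twoForm_apply hη hX hY),
      mlieBracket_smul_left hf hX, mlieBracket_smul_left hf hX]
    simp only [extDerivTwo, Pi.smul_apply', map_smul, map_add, add_apply, smul_apply, smul_eq_mul]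
    ring
  · intro X X' hX hX'
    rw [extDerivTwo,
      mvfderiv_form_add_left (mdifferentiableAt_twoForm_apply hη hX hZ)
        (mdifferentiableAt_twoForm_apply hη hX' hZ),
      mvfderiv_form_add_left (mdifferentiableAt_twoForm_apply hη hX hY)
        (mdifferentiableAt_twoForm_apply hη hX' hY),
      mlieBracket_add_left hX hX', mlieBracket_add_left hX hX']
    simp only [extDerivTwo, Pi.add_apply, map_add, add_apply]
    ring

theorem extDerivTwo_congr (hη₀ : ∀ p a, η p a a = 0)
    (hη : ContMDiff 𝓘(ℝ, F) (𝓘(ℝ, F).prod 𝓘(ℝ, F →L[ℝ] F →L[ℝ] ℝ)) ∞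
      (fun p => TotalSpace.mk' (F →L[ℝ] F →L[ℝ] ℝ) p (η p)))
    {S S' T T' U U' : Cₛ^∞⟮𝓘(ℝ, F); F, (TangentSpace 𝓘(ℝ, F) : O → Type _)⟯} {p : O}
    (hS : S p = S' p) (hT : T p = T' p) (hU : U p = U' p) :
    extDerivTwo η S T U p = extDerivTwo η S' T' U' p := by
  have congr_left {S S' : Cₛ^∞⟮𝓘(ℝ, F); F, (TangentSpace 𝓘(ℝ, F) : O → Type _)⟯}
      (T U : Cₛ^∞⟮𝓘(ℝ, F); F, (TangentSpace 𝓘(ℝ, F) : O → Type _)⟯) (hSS' : S p = S' p) :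
      extDerivTwo η S T U p = extDerivTwo η S' T U p :=
    (tensorialAt_extDerivTwo hη (mdifferentiableAt_vectorField T p)
      (mdifferentiableAt_vectorField U p)).pointwise (mdifferentiableAt_vectorField S p)
      (mdifferentiableAt_vectorField S' p) hSS'
  calc extDerivTwo η S T U p
      = extDerivTwo η S' T U p := congr_left T U hS
    _ = -extDerivTwo η T S' U p := extDerivTwo_swap_left hη₀ _ _ _ p
    _ = -extDerivTwo η T' S' U p := by rw [congr_left S' U hT]
    _ = -extDerivTwo η U T' S' p := by
      rw [extDerivTwo_swap_right hη₀, extDerivTwo_swap_left hη₀, neg_neg]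
    _ = -extDerivTwo η U' T' S' p := by rw [congr_left T' S' hU]
    _ = extDerivTwo η S' T' U' p := by
      rw [extDerivTwo_swap_left hη₀, extDerivTwo_swap_right hη₀, extDerivTwo_swap_left hη₀,
        neg_neg, neg_neg]

end TwoForms

namespace SymplecticForm

variable {E : Type*} [NormedAddCommGroup E] [NormedSpace ℝ E]
  {M : Type*} [TopologicalSpace M] [ChartedSpace E M] [IsManifold 𝓘(ℝ, E) ∞ M]
  {V : Type*} [NormedAddCommGroup V] [NormedSpace ℝ V]
  {A : M → Type*} [TopologicalSpace (TotalSpace V A)]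
  [∀ x, AddCommGroup (A x)] [∀ x, Module ℝ (A x)] [∀ x, TopologicalSpace (A x)]
  [FiberBundle V A] [VectorBundle ℝ V A]
  {𝓐 : LieAlgebroid E V A} (Ω : SymplecticForm 𝓐)

theorem form_congr_of_mem_orth_L {x : M} {a a' b b' : A x} (ha' : a' ∈ Ω.orth x (𝓐.L x))
    (hb : b ∈ Ω.orth x (𝓐.L x)) (haa' : 𝓐.anchor x a = 𝓐.anchor x a')
    (hbb' : 𝓐.anchor x b = 𝓐.anchor x b') : Ω.form x a b = Ω.form x a' b' :=
  calc Ω.form x a b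
      = Ω.form x a' b := by
        rw [Ω.skew x a, Ω.skew x a', ← sub_eq_zero, sub_neg_eq_add, neg_add_eq_sub, ← map_sub]
        exact hb _ (LinearMap.sub_mem_ker_iff.2 haa'.symm)
    _ = Ω.form x a' b' := by
        rw [← sub_eq_zero, ← map_sub]
        exact ha' _ (LinearMap.sub_mem_ker_iff.2 hbb')

end SymplecticForm

theorem eq_zero_of_forall_mvfderiv_apply {E : Type*} [NormedAddCommGroup E] [NormedSpace ℝ E]
    [FiniteDimensional ℝ E] {M : Type*} [TopologicalSpace M] [ChartedSpace E M]
    [IsManifold 𝓘(ℝ, E) ∞ M] [T2Space M] {x : M} {v : TangentSpace 𝓘(ℝ, E) x}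
    (hv : ∀ f : C^∞⟮𝓘(ℝ, E), M; ℝ⟯, mvfderiv 𝓘(ℝ, E) f x v = 0) : v = 0 := by
  have : SeparatingDual ℝ (TangentSpace 𝓘(ℝ, E) x) := inferInstanceAs (SeparatingDual ℝ E)
  refine SeparatingDual.eq_zero_of_forall_dual_eq_zero (R := ℝ) fun θ => ?_
  obtain ⟨f, rfl⟩ := exists_mvfderiv_eq x θ
  exact hv f

namespace IsIntegralSubmanifold

variable {E : Type*} [NormedAddCommGroup E] [NormedSpace ℝ E]
  {M : Type*} [TopologicalSpace M] [ChartedSpace E M]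
  {F : Type*} [NormedAddCommGroup F] [NormedSpace ℝ F]
  {O : Type*} [TopologicalSpace O] [ChartedSpace F O] {ι : O → M}

section Restriction

variable {D : ∀ x : M, Submodule ℝ (TangentSpace 𝓘(ℝ, E) x)}
  (hι : IsIntegralSubmanifold (F := F) D ι)

/-- The restriction of a smooth function to an integral submanifold. -/
noncomputable def restrict (f : C^∞⟮𝓘(ℝ, E), M; ℝ⟯) : C^∞⟮𝓘(ℝ, F), O; ℝ⟯ :=
  f.comp ⟨ι, hι.contMDiff⟩

theorem mvfderiv_restrict (f : C^∞⟮𝓘(ℝ, E), M; ℝ⟯) (p : O) (v : TangentSpace 𝓘(ℝ, F) p) :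
    mvfderiv 𝓘(ℝ, F) (hι.restrict f) p v =
      mvfderiv 𝓘(ℝ, E) f (ι p) (mfderiv 𝓘(ℝ, F) 𝓘(ℝ, E) ι p v) := by
  have hcomp := mfderiv_comp p (f.contMDiff.mdifferentiable (by simp) (ι p))
    (hι.contMDiff.mdifferentiable (by simp) p)
  exact DFunLike.congr_fun hcomp v

end Restriction

variable [IsManifold 𝓘(ℝ, E) ∞ M]
  {V : Type*} [NormedAddCommGroup V] [NormedSpace ℝ V] [FiniteDimensional ℝ V]
  {A : M → Type*} [TopologicalSpace (TotalSpace V A)]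
  [∀ x, AddCommGroup (A x)] [∀ x, Module ℝ (A x)] [∀ x, TopologicalSpace (A x)]
  [FiberBundle V A] [VectorBundle ℝ V A]
  {𝓐 : LieAlgebroid E V A} {τ : CompatibleTriple 𝓐}
  (hι : IsIntegralSubmanifold (F := F) τ.Λ ι)

section InducedForm

variable [FiniteDimensional ℝ F]

include hι in
theorem exists_lift (p : O) : ∃ s : TangentSpace 𝓘(ℝ, F) p →ₗ[ℝ] A (ι p),
    (∀ v, s v ∈ τ.Ω.orth (ι p) (𝓐.L (ι p))) ∧
    ∀ v, 𝓐.anchor (ι p) (s v) = mfderiv 𝓘(ℝ, F) 𝓘(ℝ, E) ι p v := by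
  have : Module.Free ℝ (TangentSpace 𝓘(ℝ, F) p) := inferInstanceAs (Module.Free ℝ F)
  let anchorOrth :=
    (𝓐.anchor (ι p)).toLinearMap.submoduleMap (τ.Ω.orth (ι p) (𝓐.L (ι p)))
  let dι := (mfderiv 𝓘(ℝ, F) 𝓘(ℝ, E) ι p).toLinearMap.codRestrict
    ((τ.Ω.orth (ι p) (𝓐.L (ι p))).map (𝓐.anchor (ι p)).toLinearMap) fun v => by
      rw [← τ.Λ_eq_map_orth, ← hι.range_mfderiv p]
      exact LinearMap.mem_range_self _ v
  obtain ⟨s, hs⟩ := Module.projective_lifting_property anchorOrth dι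
    (LinearMap.submoduleMap_surjective _ _)
  exact ⟨(Submodule.subtype _).comp s, fun v => (s v).2,
    fun v => congrArg Subtype.val (LinearMap.congr_fun hs v)⟩

variable [∀ x, IsTopologicalAddGroup (A x)]

/-- The 2-form induced on an integral submanifold `ι` of `Λ`: the value of `ω` on lifts of
`dι u` and `dι v` to the `ω`-orthogonal `E² + L¹` of the isotropy. -/
noncomputable def inducedForm (p : O) :
    TangentSpace 𝓘(ℝ, F) p →L[ℝ] TangentSpace 𝓘(ℝ, F) p →L[ℝ] ℝ :=
  have : ContinuousSMul ℝ (A (ι p)) :=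
    (VectorBundle.continuousLinearEquivAt ℝ V A (ι p)).continuousSMul
  let s : F →L[ℝ] A (ι p) := LinearMap.toContinuousLinearMap (hι.exists_lift p).choose
  (ContinuousLinearMap.precomp ℝ s).comp ((τ.Ω.form (ι p)).comp s)

theorem inducedForm_apply {p : O} {u v : TangentSpace 𝓘(ℝ, F) p} {a b : A (ι p)}
    (hb : b ∈ τ.Ω.orth (ι p) (𝓐.L (ι p)))
    (hau : 𝓐.anchor (ι p) a = mfderiv 𝓘(ℝ, F) 𝓘(ℝ, E) ι p u)
    (hbv : 𝓐.anchor (ι p) b = mfderiv 𝓘(ℝ, F) 𝓘(ℝ, E) ι p v) :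
    hι.inducedForm p u v = τ.Ω.form (ι p) a b := by
  obtain ⟨mem_orth, anchor_eq⟩ := (hι.exists_lift p).choose_spec
  exact (τ.Ω.form_congr_of_mem_orth_L (mem_orth u) hb (hau.trans (anchor_eq u).symm)
    (hbv.trans (anchor_eq v).symm)).symm

theorem inducedForm_self (p : O) (v : TangentSpace 𝓘(ℝ, F) p) : hι.inducedForm p v v = 0 :=
  τ.Ω.alternating _ _

end InducedForm

variable [FiniteDimensional ℝ E] [∀ x, IsTopologicalAddGroup (A x)]
  [∀ x, ContinuousConstSMul ℝ (A x)]

include hι in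
theorem exists_hamiltonianField (f : C^∞⟮𝓘(ℝ, E), M; ℝ⟯) (p : O) :
    ∃ v : TangentSpace 𝓘(ℝ, F) p, mfderiv 𝓘(ℝ, F) 𝓘(ℝ, E) ι p v =
      𝓐.anchor (ι p) (τ.Ω.hamiltonian f (ι p)) := by
  have anchor_mem : 𝓐.anchor (ι p) (τ.Ω.hamiltonian f (ι p)) ∈
      LinearMap.range (mfderiv 𝓘(ℝ, F) 𝓘(ℝ, E) ι p).toLinearMap := by
    rw [hι.range_mfderiv p, ← τ.range_poissonTensor]
    exact ⟨_, τ.Ω.poissonTensor_mvfderiv f (ι p)⟩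
  exact anchor_mem

/-- The vector field on an integral submanifold of `Λ` induced by the Hamiltonian section of a
function on the ambient manifold. -/
noncomputable def hamiltonianField (f : C^∞⟮𝓘(ℝ, E), M; ℝ⟯) (p : O) : TangentSpace 𝓘(ℝ, F) p :=
  (hι.exists_hamiltonianField f p).choose

theorem mfderiv_hamiltonianField (f : C^∞⟮𝓘(ℝ, E), M; ℝ⟯) (p : O) :
    mfderiv 𝓘(ℝ, F) 𝓘(ℝ, E) ι p (hι.hamiltonianField f p) =
      𝓐.anchor (ι p) (τ.Ω.hamiltonian f (ι p)) :=
  (hι.exists_hamiltonianField f p).choose_spec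

theorem mvfderiv_restrict_hamiltonianField (f h : C^∞⟮𝓘(ℝ, E), M; ℝ⟯) (p : O) :
    mvfderiv 𝓘(ℝ, F) (hι.restrict f) p (hι.hamiltonianField h p) =
      τ.Ω.poissonBracket f h (ι p) := by
  rw [mvfderiv_restrict, mfderiv_hamiltonianField, SymplecticForm.poissonBracket_apply]

section Surjectivity

variable [T2Space M]

theorem exists_hamiltonianField_eq (p : O) (v : TangentSpace 𝓘(ℝ, F) p) :
    ∃ f : C^∞⟮𝓘(ℝ, E), M; ℝ⟯, hι.hamiltonianField f p = v := by
  have dι_mem : mfderiv 𝓘(ℝ, F) 𝓘(ℝ, E) ι p v ∈ LinearMap.range (τ.Ω.poissonTensor (ι p)) := by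
    rw [τ.range_poissonTensor, ← hι.range_mfderiv p]
    exact LinearMap.mem_range_self _ v
  obtain ⟨θ, hθ⟩ := dι_mem
  obtain ⟨f, rfl⟩ := exists_mvfderiv_eq (ι p) θ
  refine ⟨f, hι.immersion p ?_⟩
  rw [mfderiv_hamiltonianField, ← hθ, SymplecticForm.poissonTensor_mvfderiv]

end Surjectivity

variable [FiniteDimensional ℝ F]

theorem inducedForm_hamiltonianField (f : C^∞⟮𝓘(ℝ, E), M; ℝ⟯) (p : O)
    (v : TangentSpace 𝓘(ℝ, F) p) :
    hι.inducedForm p (hι.hamiltonianField f p) v = mvfderiv 𝓘(ℝ, F) (hι.restrict f) p v := by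
  obtain ⟨s, hs, anchor_s⟩ := hι.exists_lift p
  rw [hι.inducedForm_apply (hs v) (hι.mfderiv_hamiltonianField f p).symm (anchor_s v),
    SymplecticForm.form_hamiltonian,
    mvfderiv_restrict, ← anchor_s]
  rfl

theorem inducedForm_hamiltonianField_hamiltonianField (f h : C^∞⟮𝓘(ℝ, E), M; ℝ⟯) (p : O) :
    hι.inducedForm p (hι.hamiltonianField f p) (hι.hamiltonianField h p) =
      τ.Ω.poissonBracket f h (ι p) := by
  rw [inducedForm_hamiltonianField, mvfderiv_restrict_hamiltonianField]

variable [T2Space M]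

theorem inducedForm_nondegenerate {p : O} {v : TangentSpace 𝓘(ℝ, F) p}
    (hv : ∀ w, hι.inducedForm p v w = 0) : v = 0 := by
  refine hι.immersion p ((eq_zero_of_forall_mvfderiv_apply fun f => ?_).trans (map_zero _).symm)
  rw [← mvfderiv_restrict hι, ← inducedForm_hamiltonianField,
    apply_swap_of_apply_self (hι.inducedForm_self p), hv, neg_zero]

end IsIntegralSubmanifold

namespace IsIntegralSubmanifold

variable {E : Type*} [NormedAddCommGroup E] [NormedSpace ℝ E] [FiniteDimensional ℝ E]
  {M : Type*} [TopologicalSpace M] [ChartedSpace E M] [IsManifold 𝓘(ℝ, E) ∞ M] [T2Space M]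
  {V : Type*} [NormedAddCommGroup V] [NormedSpace ℝ V] [FiniteDimensional ℝ V]
  {A : M → Type*} [TopologicalSpace (TotalSpace V A)]
  [∀ x, AddCommGroup (A x)] [∀ x, Module ℝ (A x)] [∀ x, TopologicalSpace (A x)]
  [∀ x, IsTopologicalAddGroup (A x)] [∀ x, ContinuousConstSMul ℝ (A x)]
  [FiberBundle V A] [VectorBundle ℝ V A] [ContMDiffVectorBundle ∞ V A 𝓘(ℝ, E)]
  {𝓐 : LieAlgebroid E V A} {τ : CompatibleTriple 𝓐}
  {F : Type*} [NormedAddCommGroup F] [NormedSpace ℝ F] [FiniteDimensional ℝ F]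
  {O : Type*} [TopologicalSpace O] [ChartedSpace F O] [IsManifold 𝓘(ℝ, F) ∞ O]
  {ι : O → M} (hι : IsIntegralSubmanifold (F := F) τ.Λ ι)

theorem contMDiff_hamiltonianField (f : C^∞⟮𝓘(ℝ, E), M; ℝ⟯) :
    ContMDiff 𝓘(ℝ, F) 𝓘(ℝ, F).tangent ∞
      (fun p => (⟨p, hι.hamiltonianField f p⟩ : TangentBundle 𝓘(ℝ, F) O)) := by
  intro p₀
  let b : Module.Basis _ ℝ (TangentSpace 𝓘(ℝ, F) p₀) := Module.finBasis ℝ F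
  choose c hc using fun i => hι.exists_hamiltonianField_eq p₀ (b i)
  refine contMDiffAt_section_of_linearForms (V := F) (A := (TangentSpace 𝓘(ℝ, F) : O → Type _))
    (fun i p => (mvfderiv 𝓘(ℝ, F) (hι.restrict (c i)) p).toLinearMap)
    (fun i t ht => contMDiffAt_mvfderiv_apply _ ht) (fun v hv => ?_) (fun i => ?_)
  · have form_eq_zero : (hι.inducedForm p₀ v).toLinearMap = 0 := b.ext fun i => by
      refine (apply_swap_of_apply_self (hι.inducedForm_self p₀) _ _).trans (neg_eq_zero.2 ?_)
      rw [← hc, inducedForm_hamiltonianField]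
      exact hv i
    exact hι.inducedForm_nondegenerate (LinearMap.congr_fun form_eq_zero)
  · exact ((τ.Ω.contMDiff_poissonBracket (c i) f).comp hι.contMDiff p₀).congr_of_eventuallyEq
      (.of_forall fun p => hι.mvfderiv_restrict_hamiltonianField _ _ p)

theorem contMDiff_inducedForm :
    ContMDiff 𝓘(ℝ, F) (𝓘(ℝ, F).prod 𝓘(ℝ, F →L[ℝ] F →L[ℝ] ℝ)) ∞
      (fun p => TotalSpace.mk' (F →L[ℝ] F →L[ℝ] ℝ) p (hι.inducedForm p)) := by
  intro p₀
  let b : Module.Basis _ ℝ (TangentSpace 𝓘(ℝ, F) p₀) := Module.finBasis ℝ F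
  choose c hc using fun i => hι.exists_hamiltonianField_eq p₀ (b i)
  refine contMDiffAt_section_of_linearForms (V := F →L[ℝ] F →L[ℝ] ℝ)
    (A := fun p : O => TangentSpace 𝓘(ℝ, F) p →L[ℝ] TangentSpace 𝓘(ℝ, F) p →L[ℝ] ℝ)
    (κ := Fin (Module.finrank ℝ F) × Fin (Module.finrank ℝ F))
    (fun ij p =>
      { toFun := fun η => η (hι.hamiltonianField (c ij.1) p) (hι.hamiltonianField (c ij.2) p)
        map_add' := fun _ _ => rfl
        map_smul' := fun _ _ => rfl }) (fun ij t ht => ?_) (fun η hη => ?_) (fun ij => ?_)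
  · have happly := ContMDiffAt.clm_bundle_apply₂ (F₁ := F) (F₂ := F) (F₃ := ℝ)
      (E₃ := Bundle.Trivial O ℝ) ht (hι.contMDiff_hamiltonianField (c ij.1) p₀)
      (hι.contMDiff_hamiltonianField (c ij.2) p₀)
    simp only [Bundle.contMDiffAt_section, Bundle.Trivial.fiberBundle_trivializationAt',
      Bundle.Trivial.trivialization_apply] at happly
    exact happly
  · have bilinForm_eq_zero : η.toBilinForm = 0 := LinearMap.BilinForm.ext_basis b fun i j => by
      rw [← hc, ← hc]
      exact hη (i, j)
    ext u v
    exact LinearMap.congr_fun₂ bilinForm_eq_zero u v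
  · exact ((τ.Ω.contMDiff_poissonBracket (c ij.1) (c ij.2)).comp hι.contMDiff
      p₀).congr_of_eventuallyEq (.of_forall fun p =>
        hι.inducedForm_hamiltonianField_hamiltonianField _ _ p)

/-- The vector field induced by a Hamiltonian section, as a smooth section. -/
noncomputable def hamiltonianSection (f : C^∞⟮𝓘(ℝ, E), M; ℝ⟯) :
    Cₛ^∞⟮𝓘(ℝ, F); F, (TangentSpace 𝓘(ℝ, F) : O → Type _)⟯ :=
  ⟨hι.hamiltonianField f, hι.contMDiff_hamiltonianField f⟩

theorem mvfderiv_inducedForm_hamiltonianSection (f h k : C^∞⟮𝓘(ℝ, E), M; ℝ⟯) (p : O) :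
    mvfderiv 𝓘(ℝ, F)
      (fun q => hι.inducedForm q (hι.hamiltonianSection h q) (hι.hamiltonianSection k q)) p
      (hι.hamiltonianSection f p) =
      τ.Ω.poissonBracket (τ.Ω.isPoissonBracket.bracket h k) f (ι p) := by
  have form_eq_restrict : (fun q => hι.inducedForm q (hι.hamiltonianSection h q)
      (hι.hamiltonianSection k q)) = hι.restrict (τ.Ω.isPoissonBracket.bracket h k) :=
    funext fun q => hι.inducedForm_hamiltonianField_hamiltonianField h k q
  rw [form_eq_restrict]
  exact hι.mvfderiv_restrict_hamiltonianField _ _ p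

theorem inducedForm_closed
    (S T U : Cₛ^∞⟮𝓘(ℝ, F); F, (TangentSpace 𝓘(ℝ, F) : O → Type _)⟯) (p : O) :
    (tangentLieAlgebroid F O).d₂ hι.inducedForm S T U p = 0 := by
  obtain ⟨f, hf⟩ := hι.exists_hamiltonianField_eq p (S p)
  obtain ⟨h, hh⟩ := hι.exists_hamiltonianField_eq p (T p)
  obtain ⟨k, hk⟩ := hι.exists_hamiltonianField_eq p (U p)
  have isHamiltonian (f : C^∞⟮𝓘(ℝ, E), M; ℝ⟯) (q : O) (v : TangentSpace 𝓘(ℝ, F) q) :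
      (tangentLieAlgebroid F O).d₀ (hι.restrict f) q v =
        hι.inducedForm q (hι.hamiltonianSection f q) v :=
    (hι.inducedForm_hamiltonianField f q v).symm
  rw [tangentLieAlgebroid_d₂, extDerivTwo_congr hι.inducedForm_self hι.contMDiff_inducedForm
    (S' := hι.hamiltonianSection f) (T' := hι.hamiltonianSection h)
    (U' := hι.hamiltonianSection k) hf.symm hh.symm hk.symm, ← tangentLieAlgebroid_d₂,
    (tangentLieAlgebroid F O).d₂_of_hamiltonian hι.inducedForm_self (isHamiltonian f)
      (isHamiltonian h) (isHamiltonian k), neg_eq_zero,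
    ← τ.Ω.isPoissonBracket.bracket_jacobi f h k (ι p)]
  simp_rw [← hι.mvfderiv_inducedForm_hamiltonianSection _ _ _ p]
  rfl

/-- The symplectic form induced on an integral submanifold of `Λ`. -/
noncomputable def inducedSymplecticForm : SymplecticForm (tangentLieAlgebroid F O) where
  form := hι.inducedForm
  contMDiff := hι.contMDiff_inducedForm
  alternating := hι.inducedForm_self
  nondegenerate _ _ := hι.inducedForm_nondegenerate
  closed := hι.inducedForm_closed

theorem isInducedForm_inducedSymplecticForm : IsInducedForm τ ι hι.inducedSymplecticForm := by
  intro p X Y a _ b hb haX hbY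
  rw [τ.E₂_sup_L₁] at hb
  exact hι.inducedForm_apply hb haX hbY

theorem eq_inducedSymplecticForm {ΩO : SymplecticForm (tangentLieAlgebroid F O)}
    (hΩO : IsInducedForm τ ι ΩO) : ΩO = hι.inducedSymplecticForm := by
  ext p X Y
  obtain ⟨s, hs, anchor_s⟩ := hι.exists_lift p
  simp_rw [← τ.E₂_sup_L₁] at hs
  rw [hΩO p X Y (s X) (hs X) (s Y) (hs Y) (anchor_s X) (anchor_s Y)]
  exact (hι.isInducedForm_inducedSymplecticForm p X Y (s X) (hs X) (s Y) (hs Y) (anchor_s X)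
    (anchor_s Y)).symm

theorem hamiltonian_inducedSymplecticForm (f : C^∞⟮𝓘(ℝ, E), M; ℝ⟯) (p : O) :
    hι.inducedSymplecticForm.hamiltonian (hι.restrict f) p = hι.hamiltonianField f p :=
  (hι.inducedSymplecticForm.eq_hamiltonian fun v =>
    (hι.inducedForm_hamiltonianField f p v).symm).symm

theorem poissonBracket_inducedSymplecticForm (f h : C^∞⟮𝓘(ℝ, E), M; ℝ⟯) (p : O) :
    hι.inducedSymplecticForm.poissonBracket (hι.restrict f) (hι.restrict h) p =
      τ.Ω.poissonBracket f h (ι p) := by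
  rw [SymplecticForm.poissonBracket, hamiltonian_inducedSymplecticForm,
    hamiltonian_inducedSymplecticForm]
  exact hι.inducedForm_hamiltonianField_hamiltonianField f h p

end IsIntegralSubmanifold

theorem mainTheorem2_general
    {E : Type*} [NormedAddCommGroup E] [NormedSpace ℝ E] [FiniteDimensional ℝ E]
    {M : Type*} [TopologicalSpace M] [ChartedSpace E M] [IsManifold 𝓘(ℝ, E) ∞ M]
    [T2Space M]
    {V : Type*} [NormedAddCommGroup V] [NormedSpace ℝ V] [FiniteDimensional ℝ V]
    {A : M → Type*} [TopologicalSpace (TotalSpace V A)]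
    [∀ x, AddCommGroup (A x)] [∀ x, Module ℝ (A x)] [∀ x, TopologicalSpace (A x)]
    [∀ x, IsTopologicalAddGroup (A x)] [∀ x, ContinuousConstSMul ℝ (A x)]
    [FiberBundle V A] [VectorBundle ℝ V A] [ContMDiffVectorBundle ∞ V A 𝓘(ℝ, E)]
    (𝓐 : LieAlgebroid E V A) (τ : CompatibleTriple 𝓐) :
    (∀ x, IsCompl (τ.E₁ x ⊔ τ.E₂ x) (τ.L₁ x ⊔ τ.L₂ x)) ∧
    IsSmoothDistribution τ.Λ ∧
    IsIntegrableDistribution τ.Λ ∧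
    IsPoissonBracket τ.Ω.poissonBracket ∧
    ∀ {F : Type*} [NormedAddCommGroup F] [NormedSpace ℝ F] [FiniteDimensional ℝ F]
      {O : Type*} [TopologicalSpace O] [ChartedSpace F O] [IsManifold 𝓘(ℝ, F) ∞ O]
      (ι : O → M) (hι : IsIntegralSubmanifold τ.Λ ι),
      (∃! ΩO : SymplecticForm (tangentLieAlgebroid F O), IsInducedForm τ ι ΩO) ∧
      ∀ ΩO : SymplecticForm (tangentLieAlgebroid F O), IsInducedForm τ ι ΩO →
        IsPoissonBracket ΩO.poissonBracket ∧
        ∀ (f h : C^∞⟮𝓘(ℝ, E), M; ℝ⟯) (p : O),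
          τ.Ω.poissonBracket f h (ι p) =
            ΩO.poissonBracket (f.comp ⟨ι, hι.contMDiff⟩) (h.comp ⟨ι, hι.contMDiff⟩) p := by
  refine ⟨τ.isCompl_E_L, τ.isSmoothDistribution_Λ, τ.isIntegrableDistribution_Λ,
    τ.Ω.isPoissonBracket, fun {F} _ _ _ {O} _ _ _ ι hι => ⟨?_, fun ΩO hΩO => ?_⟩⟩
  · exact ⟨hι.inducedSymplecticForm, hι.isInducedForm_inducedSymplecticForm,
      fun _ hΩO => hι.eq_inducedSymplecticForm hΩO⟩
  · obtain rfl := hι.eq_inducedSymplecticForm hΩO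
    exact ⟨hι.inducedSymplecticForm.isPoissonBracket,
      fun f h p => (hι.poissonBracket_inducedSymplecticForm f h p).symm⟩

theorem mainTheorem2
    {E : Type*} [NormedAddCommGroup E] [NormedSpace ℝ E] [FiniteDimensional ℝ E]
    {M : Type*} [TopologicalSpace M] [ChartedSpace E M] [IsManifold 𝓘(ℝ, E) ∞ M]
    [T2Space M] [SecondCountableTopology M]
    {V : Type*} [NormedAddCommGroup V] [NormedSpace ℝ V] [FiniteDimensional ℝ V]
    {A : M → Type*} [TopologicalSpace (TotalSpace V A)]
    [∀ x, AddCommGroup (A x)] [∀ x, Module ℝ (A x)] [∀ x, TopologicalSpace (A x)]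
    [∀ x, IsTopologicalAddGroup (A x)] [∀ x, ContinuousConstSMul ℝ (A x)]
    [FiberBundle V A] [VectorBundle ℝ V A] [ContMDiffVectorBundle ∞ V A 𝓘(ℝ, E)]
    (𝓐 : LieAlgebroid E V A) (τ : CompatibleTriple 𝓐) :
    (∀ x, IsCompl (τ.E₁ x ⊔ τ.E₂ x) (τ.L₁ x ⊔ τ.L₂ x)) ∧
    IsSmoothDistribution τ.Λ ∧
    IsIntegrableDistribution τ.Λ ∧
    IsPoissonBracket τ.Ω.poissonBracket ∧
    ∀ {F : Type*} [NormedAddCommGroup F] [NormedSpace ℝ F] [FiniteDimensional ℝ F]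
      {O : Type*} [TopologicalSpace O] [ChartedSpace F O] [IsManifold 𝓘(ℝ, F) ∞ O]
      (ι : O → M) (hι : IsIntegralSubmanifold τ.Λ ι),
      (∃! ΩO : SymplecticForm (tangentLieAlgebroid F O), IsInducedForm τ ι ΩO) ∧
      ∀ ΩO : SymplecticForm (tangentLieAlgebroid F O), IsInducedForm τ ι ΩO →
        IsPoissonBracket ΩO.poissonBracket ∧
        ∀ (f h : C^∞⟮𝓘(ℝ, E), M; ℝ⟯) (p : O),
          τ.Ω.poissonBracket f h (ι p) =
            ΩO.poissonBracket (f.comp ⟨ι, hι.contMDiff⟩) (h.comp ⟨ι, hι.contMDiff⟩) p :=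
  mainTheorem2_general 𝓐 τ
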